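/- Let $K\ge 1$, $N_{\mathrm R}\ge 1$ and $N_{\mathrm B}\ge K+1$ be integers, and let $L_{\mathrm G}>0$, $\bar p>0$, $L_{\mathrm d,k}>0$ ($1\le k\le K$), $L_{\mathrm r,k}>0$ ($1\le k\le K+1$) be real numbers. Let $\boldsymbol a\in\mathbb C^{N_{\mathrm R}}$ have entries of modulus $1$ and let $\boldsymbol b\in\mathbb C^{N_{\mathrm B}}$ satisfy $\|\boldsymbol b\|_2=1$. Let the direct channels $\boldsymbol h_{\mathrm d,k}\sim\mathcal N_{\mathbb C}(\boldsymbol 0,L_{\mathrm d,k}\mathbf I)$ in $\mathbb C^{N_{\mathrm B}}$ ($1\le k\le K$) of the strong users and the reflecting channels $\boldsymbol h_{\mathrm r,k}\sim\mathcal N_{\mathbb C}(\boldsymbol 0,L_{\mathrm r,k}\mathbf I)$ in $\mathbb C^{N_{\mathrm R}}$ ($1\le k\le K+1$) of all users be mutually independent circularly symmetric complex Gaussian vectors (i.i.d. Rayleigh fading); the weak user $K+1$ has no direct channel. Define the cascaded channels by $\boldsymbol h_{\mathrm c,k}^{\mathrm H}=\sqrt{L_{\mathrm G}N_{\mathrm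 B}}\,\boldsymbol h_{\mathrm r,k}^{\mathrm H}\operatorname{diag}(\boldsymbol a)$, put $\boldsymbol H_{\mathrm d}^{\mathrm s}=[\boldsymbol h_{\mathrm d,1},\dots,\boldsymbol h_{\mathrm d,K}]^{\mathrm H}$, $\boldsymbol H_{\mathrm c}^{\mathrm s}=[\boldsymbol h_{\mathrm c,1},\dots,\boldsymbol h_{\mathrm c,K}]^{\mathrm H}$, $\boldsymbol C_{\mathrm s}=\boldsymbol H_{\mathrm d}^{\mathrm s}(\mathbf I-\boldsymbol b\boldsymbol b^{\mathrm H})\boldsymbol H_{\mathrm d}^{\mathrm s,\mathrm H}$ and $\boldsymbol D_{\mathrm s}=[\boldsymbol H_{\mathrm c}^{\mathrm s},\ \boldsymbol H_{\mathrm d}^{\mathrm s}\boldsymbol b]$. For a phase vector $\boldsymbol\theta\in\mathbb C^{N_{\mathrm R}}$ put $\bar{\boldsymbol\theta}=[\boldsymbol\theta^{\mathrm H}\ 1]^{\mathrm H}$, and define the phase-dependent parts of the high-SNR spectral efficiencies of linear precoding and of dirty paper coding by $$\overline{\mathrm{SE}}_{\mathrm{Lin},\mathrm r}=\log_2\left(\frac{|\boldsymbol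 h_{\mathrm c,K+1}^{\mathrm H}\boldsymbol\theta|^2\,\bar p}{1+\bar{\boldsymbol\theta}^{\mathrm H}\boldsymbol D_{\mathrm s}^{\mathrm H}\boldsymbol C_{\mathrm s}^{-1}\boldsymbol D_{\mathrm s}\bar{\boldsymbol\theta}}\right),\qquad \overline{\mathrm{SE}}_{\mathrm{DPC},\mathrm r}=\log_2\left(|\boldsymbol h_{\mathrm c,K+1}^{\mathrm H}\boldsymbol\theta|^2\,\bar p\right).$$ Choose $\boldsymbol\theta=\exp(\mathrm j\arg(\boldsymbol h_{\mathrm c,K+1}))$ (entrywise), which maximizes the channel gain of the weak user. Then both quantities are integrable, $$\mathbb E\big[\overline{\mathrm{SE}}_{\mathrm{Lin},\mathrm r}\big]\le\log_2\left(\frac{\pi e^{\gamma}}{4}\,N_{\mathrm R}N_{\mathrm B}\,\frac{L_{\mathrm r,K+1}\,\bar p}{\sum_{k=1}^{K}L_{\mathrm r,k}/L_{\mathrm d,k}}\right),$$ where $\gamma$ is the Euler–Mascheroni constant, so that this bound scales linearly in $N_{\mathrm R}$ inside the logarithm, whereas $$\mathbb E\big[\overline{\mathrm{SE}}_{\mathrm{DPC},\mathrm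 r}\big]\ge\log_2\left(e^{-\gamma}L_{\mathrm G}L_{\mathrm r,K+1}N_{\mathrm B}N_{\mathrm R}^2\,\bar p\right),$$ which scales quadratically in $N_{\mathrm R}$ inside the logarithm. -/

import Mathlib

open MeasureTheory ProbabilityTheory Matrix

noncomputable section

namespace RIS

/-- The circularly symmetric complex Gaussian law `N_ℂ(0, L)` on `ℂ` with `E|z|² = L`: the real and
the imaginary part are independent real Gaussians with mean `0` and variance `L / 2`. -/
def complexGaussian (L : ℝ) : Measure ℂ :=
  ((gaussianReal 0 (L / 2).toNNReal).prod (gaussianReal 0 (L / 2).toNNReal)).map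
    (fun x : ℝ × ℝ => (⟨x.1, x.2⟩ : ℂ))

/-- The law `N_ℂ(0, L I)` on `ℂⁿ`: independent entries with law `N_ℂ(0, L)`. -/
def complexGaussianVec (n : ℕ) (L : ℝ) : Measure (Fin n → ℂ) :=
  Measure.pi fun _ => complexGaussian L

/-- Independent Rayleigh fading. The direct channels `h_{d,k}` of the strong users `k < K` and the
reflecting channels `h_{r,k}` of all users `k < K + 1` (the last one is the weak user) are mutually
independent, with `h_{d,k} ∼ N_ℂ(0, L_{d,k} I)` and `h_{r,k} ∼ N_ℂ(0, L_{r,k} I)`. -/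
structure IIDRayleigh {Ω : Type*} [MeasurableSpace Ω] (μ : Measure Ω) {K NB NR : ℕ}
    (Ld : Fin K → ℝ) (Lr : Fin (K + 1) → ℝ)
    (hd : Fin K → Ω → Fin NB → ℂ) (hr : Fin (K + 1) → Ω → Fin NR → ℂ) : Prop where
  law_direct : ∀ k, HasLaw (hd k) (complexGaussianVec NB (Ld k)) μ
  law_reflect : ∀ k, HasLaw (hr k) (complexGaussianVec NR (Lr k)) μ
  indep_direct : iIndepFun hd μ
  indep_reflect : iIndepFun hr μ
  indep_direct_reflect : IndepFun (fun ω k => hd k ω) (fun ω k => hr k ω) μ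

/-- The cascaded channel `h_c`, where `h_cᴴ = √(L_G N_B) h_rᴴ diag(a)`. -/
def cascaded {NR : ℕ} (NB : ℕ) (LG : ℝ) (a hr : Fin NR → ℂ) : Fin NR → ℂ :=
  star ((Real.sqrt (LG * NB) : ℂ) • (star hr ᵥ* diagonal a))

/-- The phase vector `θ = exp(j arg h)` (entrywise). -/
def alignedPhases {n : ℕ} (h : Fin n → ℂ) : Fin n → ℂ :=
  fun i => Complex.exp (Complex.I * (Complex.arg (h i) : ℂ))

/-- The matrix `[h_1, …, h_K]ᴴ`, whose `k`-th row is `h_kᴴ`. -/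
def stack {K n : ℕ} (h : Fin K → Fin n → ℂ) : Matrix (Fin K) (Fin n) ℂ :=
  Matrix.of fun k => star (h k)

/-- The projector `P_b^⊥ = I - b bᴴ`. -/
def projPerp {n : ℕ} (b : Fin n → ℂ) : Matrix (Fin n) (Fin n) ℂ :=
  1 - vecMulVec b (star b)

/-- `C_s = H_d P_b^⊥ H_dᴴ`. -/
def Cs {K NB : ℕ} (b : Fin NB → ℂ) (Hd : Matrix (Fin K) (Fin NB) ℂ) :
    Matrix (Fin K) (Fin K) ℂ :=
  Hd * projPerp b * Hdᴴ

/-- `D_s = [H_c, H_d b]`. -/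
def Ds {K NB NR : ℕ} (b : Fin NB → ℂ) (Hd : Matrix (Fin K) (Fin NB) ℂ)
    (Hc : Matrix (Fin K) (Fin NR) ℂ) : Matrix (Fin K) (Fin NR ⊕ Unit) ℂ :=
  fromCols Hc (replicateCol Unit (Hd *ᵥ b))

/-- `θ̄ = [θᴴ 1]ᴴ`. -/
def extPhases {NR : ℕ} (θ : Fin NR → ℂ) : Fin NR ⊕ Unit → ℂ :=
  Sum.elim θ (fun _ => 1)

/-- The channel mitigation term `θ̄ᴴ D_sᴴ C_s⁻¹ D_s θ̄`, a real number. -/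
def mitigation {K NB NR : ℕ} (b : Fin NB → ℂ) (Hd : Matrix (Fin K) (Fin NB) ℂ)
    (Hc : Matrix (Fin K) (Fin NR) ℂ) (θ : Fin NR → ℂ) : ℝ :=
  (star (extPhases θ) ⬝ᵥ
    (((Ds b Hd Hc)ᴴ * (Cs b Hd)⁻¹ * Ds b Hd Hc) *ᵥ extPhases θ)).re

/-- The phase-dependent part of the high-SNR spectral efficiency of linear precoding,
`log₂(|h_{c,K+1}ᴴ θ|² p / (1 + θ̄ᴴ D_sᴴ C_s⁻¹ D_s θ̄))`. Here `hd` are the direct channels of the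
strong users, `hc` the cascaded channels of all users. -/
def seLinR {K NB NR : ℕ} (p : ℝ) (b : Fin NB → ℂ) (hd : Fin K → Fin NB → ℂ)
    (hc : Fin (K + 1) → Fin NR → ℂ) (θ : Fin NR → ℂ) : ℝ :=
  Real.logb 2 (‖star (hc (Fin.last K)) ⬝ᵥ θ‖ ^ 2 * p /
    (1 + mitigation b (stack hd) (stack fun k : Fin K => hc k.castSucc) θ))

/-- The phase-dependent part of the high-SNR spectral efficiency of dirty paper coding,
`log₂(|h_{c,K+1}ᴴ θ|² p)`. -/
def seDPCR {K NR : ℕ} (p : ℝ) (hc : Fin (K + 1) → Fin NR → ℂ) (θ : Fin NR → ℂ) : ℝ :=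
  Real.logb 2 (‖star (hc (Fin.last K)) ⬝ᵥ θ‖ ^ 2 * p)

end RIS

end

noncomputable section

namespace RIS

open scoped ENNReal

/-! Aligned phases turn the weak user's gain into `√(LG * NB) * ∑ n, ‖h n‖`. The squared modulus of
a complex Gaussian of variance `L` is `L` times a standard exponential `T`, with `E log T = Γ'(1) =
-γ` and `E √T = √π / 2`. Concavity of the logarithm bounds the mean log-gain below by averaging `log
‖h n‖`, which is the dirty paper bound, and above by the logarithm of the mean.

For linear precoding the mean of `log (1 + M)`, with `M` the mitigation term, must also be bounded
below. `M` is the squared norm of the shortest `w` orthogonal to `b` with `H_d w = H_c θ + H_d b`.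
So `w - b` has squared norm `1 + M` and `H_d` maps it to the reflected gains `v = H_c θ`.
Cauchy–Schwarz tested with `c k = v k / Ld k` gives `Q ^ 2 ≤ R * (1 + M)`, where `Q = ∑ ‖v k‖ ^ 2 /
Ld k` and `R = ‖H_dᴴ c‖ ^ 2` (`norm_star_dotProduct_sq_le_mitigation`). Given the reflecting
channels, `R` has mean `NB * Q`, so `E log (R / Q) ≤ log NB`. Each `v k` is Gaussian because the
phases depend only on the independent weak user (`measurePreserving_reflected`); weighted concavity
then bounds `E log Q` below at the cost of one `γ`.

Integrability of `log (1 + M)` needs an upper bound: `M` is at most the squared norm of an explicit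
feasible vector, rational in the channels with denominator a `(K + 1)`-square determinant. The
logarithm of that determinant is integrable by induction on leading minors, each affine in a fresh
Gaussian entry (`negLogFinite_leadingMinor`). -/

/-! ### The exponential law and its logarithmic mean. -/

/-- The standard exponential law, as a measure on `ℝ`. -/
def stdExponential : Measure ℝ :=
  (volume.restrict (Set.Ioi 0)).withDensity fun t => ENNReal.ofReal (Real.exp (-t))

lemma lintegral_stdExponential {f : ℝ → ℝ≥0∞} (hf : Measurable f) :
    ∫⁻ t, f t ∂stdExponential = ∫⁻ t in Set.Ioi 0, ENNReal.ofReal (Real.exp (-t)) * f t := by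
  unfold stdExponential
  rw [lintegral_withDensity_eq_lintegral_mul _ (by fun_prop) hf]
  rfl

lemma integral_stdExponential (f : ℝ → ℝ) :
    ∫ t, f t ∂stdExponential = ∫ t in Set.Ioi 0, Real.exp (-t) * f t := by
  unfold stdExponential
  rw [integral_withDensity_eq_integral_toReal_smul (by fun_prop) (by simp)]
  simp [ENNReal.toReal_ofReal (Real.exp_pos _).le]

lemma integrable_stdExponential_iff (f : ℝ → ℝ) :
    Integrable f stdExponential ↔
      IntegrableOn (fun t => Real.exp (-t) * f t) (Set.Ioi 0) := by
  unfold stdExponential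
  rw [integrable_withDensity_iff_integrable_smul' (by fun_prop) (by simp)]
  simp [ENNReal.toReal_ofReal (Real.exp_pos _).le, IntegrableOn]

lemma integrable_rpow_stdExponential {s : ℝ} (hs : 0 < s) :
    Integrable (fun t => t ^ (s - 1)) stdExponential :=
  (integrable_stdExponential_iff _).2 (Real.GammaIntegral_convergent hs)

lemma integral_rpow_stdExponential {s : ℝ} (hs : 0 < s) :
    ∫ t, t ^ (s - 1) ∂stdExponential = Real.Gamma s := by
  rw [integral_stdExponential, Real.Gamma_eq_integral hs]

/-- Differentiating the Gamma integral under the integral sign at `1` brings down `log t`, and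
`Γ'(1) = -γ`. -/
lemma setIntegral_log_mul_exp_neg :
    ∫ t in Set.Ioi (0 : ℝ), Real.log t * Real.exp (-t) = -Real.eulerMascheroniConstant := by
  have h1 := Complex.hasDerivAt_GammaIntegral (s := 1) (by simp)
  have h2 : HasDerivAt Complex.Gamma
      (∫ t : ℝ in Set.Ioi 0, (t : ℂ) ^ ((1 : ℂ) - 1) * (Real.log t * Real.exp (-t))) 1 := by
    refine h1.congr_of_eventuallyEq ?_
    have : IsOpen {s : ℂ | 0 < s.re} := Complex.continuous_re.isOpen_preimage _ isOpen_Ioi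
    filter_upwards [this.mem_nhds (show (1 : ℂ) ∈ {s : ℂ | 0 < s.re} by simp)] with s hs
    exact Complex.Gamma_eq_integral hs
  have h3 := h2.unique Complex.hasDerivAt_Gamma_one
  simp only [sub_self, Complex.cpow_zero, one_mul] at h3
  rw [← Complex.ofReal_inj, ← integral_complex_ofReal]
  push_cast at h3 ⊢
  exact h3

lemma eulerMascheroniConstant_ne_zero : Real.eulerMascheroniConstant ≠ 0 := by
  have := Real.one_half_lt_eulerMascheroniConstant
  linarith

lemma integral_log_stdExponential :
    ∫ t, Real.log t ∂stdExponential = -Real.eulerMascheroniConstant := by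
  rw [integral_stdExponential, ← setIntegral_log_mul_exp_neg]
  simp_rw [mul_comm]

/-- The Bochner integral of a non-integrable function is `0` by convention, whereas this one equals
`-γ ≠ 0`. -/
lemma integrable_log_stdExponential : Integrable Real.log stdExponential := by
  by_contra h
  have := integral_undef h
  rw [integral_log_stdExponential] at this
  exact eulerMascheroniConstant_ne_zero (neg_eq_zero.1 this)

/-! ### Complex Gaussians: modulus and linear combinations. -/

lemma measurable_complexMk : Measurable fun x : ℝ × ℝ => (⟨x.1, x.2⟩ : ℂ) :=
  Complex.measurableEquivRealProd.symm.measurable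

instance (L : ℝ) : IsProbabilityMeasure (complexGaussian L) :=
  Measure.isProbabilityMeasure_map measurable_complexMk.aemeasurable

instance (n : ℕ) (L : ℝ) : IsProbabilityMeasure (complexGaussianVec n L) := by
  unfold complexGaussianVec
  infer_instance

/-- In polar coordinates the planar density is radial, the angle contributes `2π`, and the
substitution `t = r ^ 2 / L` turns the radial density into `exp (-t)`. -/
lemma lintegral_complexGaussian_norm_sq {L : ℝ} (hL : 0 < L) {φ : ℝ → ℝ≥0∞} (hφ : Measurable φ) :
    ∫⁻ z, φ (‖z‖ ^ 2) ∂complexGaussian L = ∫⁻ t, φ (L * t) ∂stdExponential := by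
  have hv : (L / 2).toNNReal ≠ 0 := by simpa using hL
  have hvc : ((L / 2).toNNReal : ℝ) = L / 2 := Real.coe_toNNReal _ (by positivity)
  have himg : (fun r : ℝ => r ^ 2 / L) '' Set.Ioi 0 = Set.Ioi 0 := by
    ext t
    constructor
    · rintro ⟨r, hr, rfl⟩
      have : 0 < r := hr
      exact div_pos (pow_pos this 2) hL
    · intro ht
      have : 0 < t := ht
      refine ⟨Real.sqrt (L * t), Real.sqrt_pos.2 (by positivity), ?_⟩
      simp only
      rw [Real.sq_sqrt (by positivity)]
      field_simp
  have hinj : Set.InjOn (fun r : ℝ => r ^ 2 / L) (Set.Ioi 0) := by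
    intro x hx y hy hxy
    have hx' : 0 < x := hx
    have hy' : 0 < y := hy
    have : x ^ 2 = y ^ 2 := by simpa [div_left_inj' hL.ne'] using hxy
    exact (pow_left_inj₀ hx'.le hy'.le two_ne_zero).1 this
  have hder : ∀ x ∈ Set.Ioi (0 : ℝ),
      HasDerivWithinAt (fun r : ℝ => r ^ 2 / L) (2 * x / L) (Set.Ioi 0) x := fun x _ => by
    have := ((hasDerivAt_pow 2 x).div_const L).hasDerivWithinAt (s := Set.Ioi 0)
    simpa using this
  rw [lintegral_stdExponential (by fun_prop), ← himg,
    lintegral_image_eq_lintegral_abs_deriv_mul measurableSet_Ioi hder hinj]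
  have hmeas : Measurable fun z : ℂ => φ (‖z‖ ^ 2) := by fun_prop
  have hcomp : Measurable fun x : ℝ × ℝ => φ (‖(⟨x.1, x.2⟩ : ℂ)‖ ^ 2) :=
    hmeas.comp measurable_complexMk
  unfold complexGaussian
  rw [lintegral_map hmeas measurable_complexMk, gaussianReal_of_var_ne_zero _ hv,
    prod_withDensity (by fun_prop) (by fun_prop),
    lintegral_withDensity_eq_lintegral_mul _ (by fun_prop) hcomp, ← Measure.volume_eq_prod,
    ← lintegral_comp_polarCoord_symm, polarCoord_target, Measure.volume_eq_prod,
    setLIntegral_prod _ (by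
      refine Measurable.aemeasurable ?_
      simp only [Pi.mul_apply, smul_eq_mul]
      have h1 : Measurable (fun p : ℝ × ℝ => polarCoord.symm p) := by
        simp only [polarCoord_symm_apply]
        fun_prop
      refine (by fun_prop : Measurable fun p : ℝ × ℝ => ENNReal.ofReal p.1).mul (Measurable.mul ?_ ?_)
      · exact (by fun_prop : Measurable fun z : ℝ × ℝ => gaussianPDF 0 (L / 2).toNNReal z.1 *
          gaussianPDF 0 (L / 2).toNNReal z.2).comp h1
      · exact hcomp.comp h1)]
  refine setLIntegral_congr_fun measurableSet_Ioi fun r hr => ?_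
  have hr' : 0 < r := hr
  have hnorm : ∀ t : ℝ, ‖(⟨r * Real.cos t, r * Real.sin t⟩ : ℂ)‖ ^ 2 = r ^ 2 := fun t => by
    rw [← Complex.normSq_eq_norm_sq, Complex.normSq_mk]
    linear_combination r ^ 2 * Real.sin_sq_add_cos_sq t
  have hpdf : ∀ t : ℝ, gaussianPDF 0 (L / 2).toNNReal (r * Real.cos t) *
      gaussianPDF 0 (L / 2).toNNReal (r * Real.sin t) =
        ENNReal.ofReal ((Real.pi * L)⁻¹ * Real.exp (-(r ^ 2 / L))) := fun t => by
    rw [gaussianPDF_def, ← ENNReal.ofReal_mul (gaussianPDFReal_nonneg _ _ _)]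
    congr 1
    unfold gaussianPDFReal
    rw [hvc, mul_mul_mul_comm, ← Real.exp_add, ← mul_inv, Real.mul_self_sqrt (by positivity)]
    congr 2
    · ring
    · field_simp
      linear_combination -r ^ 2 * Real.sin_sq_add_cos_sq t
  simp only [Pi.mul_apply, polarCoord_symm_apply, hnorm, hpdf, smul_eq_mul,
    lintegral_const, Measure.restrict_apply MeasurableSet.univ, Set.univ_inter, Real.volume_Ioo]
  rw [show L * (r ^ 2 / L) = r ^ 2 by field_simp, ← mul_assoc, ← mul_assoc,
    mul_right_comm, ← ENNReal.ofReal_mul hr'.le, ← ENNReal.ofReal_mul (by positivity),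
    ← ENNReal.ofReal_mul (by positivity)]
  congr 2
  rw [abs_of_pos (by positivity)]
  field_simp
  ring

lemma map_norm_sq_complexGaussian {L : ℝ} (hL : 0 < L) :
    (complexGaussian L).map (fun z => ‖z‖ ^ 2) = stdExponential.map (fun t => L * t) := by
  ext s hs
  have h := lintegral_complexGaussian_norm_sq hL (φ := s.indicator 1)
    (measurable_one.indicator hs)
  have e1 : ∀ z : ℂ, s.indicator (1 : ℝ → ℝ≥0∞) (‖z‖ ^ 2) =
    ((fun z : ℂ => ‖z‖ ^ 2) ⁻¹' s).indicator 1 z := fun z => rfl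
  have e2 : ∀ t : ℝ, s.indicator (1 : ℝ → ℝ≥0∞) (L * t) =
    ((fun t : ℝ => L * t) ⁻¹' s).indicator 1 t := fun z => rfl
  simp_rw [e1, e2] at h
  have m1 : Measurable fun z : ℂ => ‖z‖ ^ 2 := by fun_prop
  have m2 : Measurable fun t : ℝ => L * t := by fun_prop
  rw [lintegral_indicator_one (m1 hs), lintegral_indicator_one (m2 hs)] at h
  rw [Measure.map_apply m1 hs, Measure.map_apply m2 hs, h]

lemma integrable_comp_norm_sq_complexGaussian {L : ℝ} (hL : 0 < L) {f : ℝ → ℝ}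
    (hf : Measurable f) :
    Integrable (fun z => f (‖z‖ ^ 2)) (complexGaussian L) ↔
      Integrable (fun t => f (L * t)) stdExponential := by
  have m1 : Measurable fun z : ℂ => ‖z‖ ^ 2 := by fun_prop
  have m2 : Measurable fun t : ℝ => L * t := by fun_prop
  have h1 := integrable_map_measure (μ := complexGaussian L) (f := fun z : ℂ => ‖z‖ ^ 2) (g := f)
    hf.aestronglyMeasurable m1.aemeasurable
  have h2 := integrable_map_measure (μ := stdExponential) (f := fun t : ℝ => L * t) (g := f)
    hf.aestronglyMeasurable m2.aemeasurable
  rw [map_norm_sq_complexGaussian hL] at h1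
  exact h1.symm.trans h2

lemma integral_comp_norm_sq_complexGaussian {L : ℝ} (hL : 0 < L) {f : ℝ → ℝ}
    (hf : Measurable f) :
    ∫ z, f (‖z‖ ^ 2) ∂complexGaussian L = ∫ t, f (L * t) ∂stdExponential := by
  have m1 : Measurable fun z : ℂ => ‖z‖ ^ 2 := by fun_prop
  have m2 : Measurable fun t : ℝ => L * t := by fun_prop
  rw [← integral_map (φ := fun z : ℂ => ‖z‖ ^ 2) m1.aemeasurable hf.aestronglyMeasurable,
    map_norm_sq_complexGaussian hL, integral_map m2.aemeasurable hf.aestronglyMeasurable]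

instance : IsProbabilityMeasure stdExponential := by
  have h := map_norm_sq_complexGaussian one_pos
  simp only [one_mul, Measure.map_id'] at h
  rw [← h]
  exact Measure.isProbabilityMeasure_map (by fun_prop)

lemma ae_pos_stdExponential : ∀ᵐ t ∂stdExponential, 0 < t :=
  (withDensity_absolutelyContinuous _ _).ae_le (ae_restrict_mem measurableSet_Ioi)

lemma log_mul_ae_eq {L : ℝ} (hL : 0 < L) :
    (fun t => Real.log (L * t)) =ᵐ[stdExponential] fun t => Real.log L + Real.log t := by
  filter_upwards [ae_pos_stdExponential] with t ht
  exact Real.log_mul hL.ne' ht.ne'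

lemma integrable_log_norm_sq_complexGaussian {L : ℝ} (hL : 0 < L) :
    Integrable (fun z => Real.log (‖z‖ ^ 2)) (complexGaussian L) := by
  rw [integrable_comp_norm_sq_complexGaussian hL Real.measurable_log,
    integrable_congr (log_mul_ae_eq hL)]
  exact (integrable_const _).add integrable_log_stdExponential

lemma integral_log_norm_sq_complexGaussian {L : ℝ} (hL : 0 < L) :
    ∫ z, Real.log (‖z‖ ^ 2) ∂complexGaussian L = Real.log L - Real.eulerMascheroniConstant := by
  rw [integral_comp_norm_sq_complexGaussian hL Real.measurable_log,
    integral_congr_ae (log_mul_ae_eq hL),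
    integral_add (integrable_const _) integrable_log_stdExponential,
    integral_log_stdExponential]
  simp [sub_eq_add_neg]

lemma integrable_norm_complexGaussian {L : ℝ} (hL : 0 < L) :
    Integrable (fun z => ‖z‖) (complexGaussian L) := by
  have h : (fun z : ℂ => ‖z‖) = fun z => Real.sqrt (‖z‖ ^ 2) := by
    ext z; rw [Real.sqrt_sq (norm_nonneg z)]
  rw [h, integrable_comp_norm_sq_complexGaussian hL (by fun_prop)]
  simp_rw [Real.sqrt_mul hL.le]
  refine Integrable.const_mul ?_ _
  have := integrable_rpow_stdExponential (s := 3 / 2) (by norm_num)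
  norm_num at this
  exact this.congr (Filter.Eventually.of_forall fun t => by simp [Real.sqrt_eq_rpow])

/-- `E √T = Γ(3/2) = √π / 2` for `T` standard exponential. -/
lemma integral_norm_complexGaussian {L : ℝ} (hL : 0 < L) :
    ∫ z, ‖z‖ ∂complexGaussian L = Real.sqrt (Real.pi * L) / 2 := by
  have h : (fun z : ℂ => ‖z‖) = fun z => Real.sqrt (‖z‖ ^ 2) := by
    ext z; rw [Real.sqrt_sq (norm_nonneg z)]
  rw [h, integral_comp_norm_sq_complexGaussian hL (by fun_prop)]
  simp_rw [Real.sqrt_mul hL.le]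
  rw [integral_const_mul]
  have := integral_rpow_stdExponential (s := 1 / 2 + 1) (by norm_num)
  rw [Real.Gamma_add_one (by norm_num), Real.Gamma_one_half_eq, add_sub_cancel_right] at this
  simp_rw [Real.sqrt_eq_rpow] at this ⊢
  rw [this, Real.mul_rpow Real.pi_pos.le hL.le]
  ring

lemma integrable_norm_sq_complexGaussian {L : ℝ} (hL : 0 < L) :
    Integrable (fun z => ‖z‖ ^ 2) (complexGaussian L) := by
  refine (integrable_comp_norm_sq_complexGaussian hL measurable_id).2 ?_
  have := integrable_rpow_stdExponential (s := 2) (by norm_num)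
  norm_num at this
  exact this.const_mul L

lemma lintegral_norm_sq_complexGaussian {L : ℝ} (hL : 0 < L) :
    ∫⁻ z, ENNReal.ofReal (‖z‖ ^ 2) ∂complexGaussian L = ENNReal.ofReal L := by
  rw [← ofReal_integral_eq_lintegral_ofReal (integrable_norm_sq_complexGaussian hL)
    (by filter_upwards with z; positivity)]
  refine congrArg _ ((integral_comp_norm_sq_complexGaussian hL measurable_id).trans ?_)
  have := integral_rpow_stdExponential (s := 2) (by norm_num)
  norm_num at this
  simp only [id]
  rw [integral_const_mul, this, mul_one]

lemma charFun_complexGaussian {L : ℝ} (hL : 0 ≤ L) (t : ℂ) :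
    charFun (complexGaussian L) t = Complex.exp (-(L * ‖t‖ ^ 2 / 4)) := by
  have hvc : ((L / 2).toNNReal : ℝ) = L / 2 := Real.coe_toNNReal _ (by positivity)
  rw [charFun_apply, complexGaussian, integral_map measurable_complexMk.aemeasurable (by fun_prop)]
  have e : ∀ x : ℝ × ℝ, Complex.exp ((inner ℝ (⟨x.1, x.2⟩ : ℂ) t : ℝ) * Complex.I) =
      Complex.exp (t.re * x.1 * Complex.I) * Complex.exp (t.im * x.2 * Complex.I) := fun x => by
    rw [← Complex.exp_add]
    congr 1
    simp [Complex.inner]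
    ring
  simp_rw [e]
  rw [integral_prod_mul (fun x : ℝ => Complex.exp (t.re * x * Complex.I))
    (fun x : ℝ => Complex.exp (t.im * x * Complex.I)), ← charFun_apply_real, ← charFun_apply_real,
    charFun_gaussianReal, charFun_gaussianReal, ← Complex.exp_add]
  congr 1
  have hn : ((‖t‖ : ℂ)) ^ 2 = (t.re : ℂ) ^ 2 + (t.im : ℂ) ^ 2 := by
    rw [← Complex.ofReal_pow, ← Complex.normSq_eq_norm_sq, Complex.normSq_apply]
    push_cast; ring
  rw [hn, show ((((L / 2).toNNReal : NNReal) : ℝ) : ℂ) = L / 2 by rw [hvc]; push_cast; ring]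
  push_cast
  ring

/-- A conjugate-linear combination of independent circularly symmetric complex Gaussians is again
circularly symmetric complex Gaussian. -/
lemma map_sum_mul_star_complexGaussian {ι : Type*} [Fintype ι] {L : ι → ℝ} (hL : ∀ i, 0 ≤ L i)
    (c : ι → ℂ) :
    (Measure.pi fun i => complexGaussian (L i)).map (fun z => ∑ i, c i * star (z i)) =
      complexGaussian (∑ i, ‖c i‖ ^ 2 * L i) := by
  have hm : Measurable fun z : ι → ℂ => ∑ i, c i * star (z i) := by fun_prop
  have := Measure.isProbabilityMeasure_map (μ := Measure.pi fun i => complexGaussian (L i))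
    hm.aemeasurable
  refine Measure.ext_of_charFun (funext fun t => ?_)
  rw [charFun_complexGaussian (Finset.sum_nonneg fun i _ => mul_nonneg (by positivity) (hL i)),
    charFun_apply, integral_map hm.aemeasurable (by fun_prop)]
  -- Moving the conjugation from `z i` onto `t` makes the character a product over the independent
  -- coordinates.
  have e : ∀ z : ι → ℂ, Complex.exp ((inner ℝ (∑ i, c i * star (z i)) t : ℝ) * Complex.I) =
      ∏ i, Complex.exp ((inner ℝ (z i) (c i * star t) : ℝ) * Complex.I) := fun z => by
    rw [← Complex.exp_sum, ← Finset.sum_mul, sum_inner]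
    push_cast
    congr 2
    refine Finset.sum_congr rfl fun i _ => ?_
    congr 1
    simp [Complex.inner]
    ring
  simp_rw [e]
  rw [integral_fintype_prod_eq_prod (fun i (z : ℂ) =>
    Complex.exp ((inner ℝ z (c i * star t) : ℝ) * Complex.I))]
  simp_rw [← charFun_apply, charFun_complexGaussian (hL _)]
  rw [← Complex.exp_sum]
  congr 1
  simp only [norm_mul, norm_star]
  push_cast
  rw [Finset.sum_mul, Finset.sum_div, ← Finset.sum_neg_distrib]
  refine Finset.sum_congr rfl fun i _ => ?_
  ring

/-! ### Negative logarithmic moments of affine functions of a Gaussian. -/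

lemma map_re_complexGaussian (L : ℝ) :
    (complexGaussian L).map Complex.re = gaussianReal 0 (L / 2).toNNReal := by
  unfold complexGaussian
  rw [Measure.map_map Complex.measurable_re measurable_complexMk]
  exact (measurePreserving_fst (μ := gaussianReal 0 (L / 2).toNNReal)
    (ν := gaussianReal 0 (L / 2).toNNReal)).map_eq

lemma ae_re_add_ne_zero_complexGaussian {L : ℝ} (hL : 0 < L) (c : ℂ) :
    ∀ᵐ z ∂complexGaussian L, z.re + c.re ≠ 0 := by
  have hv : (L / 2).toNNReal ≠ 0 := by simpa using hL
  have := nullSingletonClass_gaussianReal (μ := 0) hv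
  have h : ∀ᵐ x ∂gaussianReal 0 (L / 2).toNNReal, x ≠ -c.re := by simp [ae_iff]
  rw [← map_re_complexGaussian] at h
  filter_upwards [ae_of_ae_map Complex.measurable_re.aemeasurable h] with z hz h0
  exact hz (by linarith)

lemma ae_add_ne_zero_complexGaussian {L : ℝ} (hL : 0 < L) (c : ℂ) :
    ∀ᵐ z ∂complexGaussian L, z + c ≠ 0 := by
  filter_upwards [ae_re_add_ne_zero_complexGaussian hL c] with z hz h0
  exact hz (by simpa using congrArg Complex.re h0)

lemma lintegral_neg_log_abs_lt_top : ∫⁻ x : ℝ, ENNReal.ofReal (-Real.log |x|) < ∞ := by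
  have h1 : IntegrableOn (fun x => -Real.log x) (Set.Icc (-1) 1) := by
    rw [integrableOn_Icc_iff_integrableOn_Ioc]
    exact ((intervalIntegrable_iff_integrableOn_Ioc_of_le (by norm_num)).1
      intervalIntegral.intervalIntegrable_log').neg
  have h2 : (fun x : ℝ => ENNReal.ofReal (-Real.log |x|)) =
      (Set.Icc (-1 : ℝ) 1).indicator fun x => ENNReal.ofReal (-Real.log x) := by
    ext x
    by_cases hx : x ∈ Set.Icc (-1 : ℝ) 1
    · simp [hx]
    · rw [Set.indicator_of_notMem hx, ENNReal.ofReal_eq_zero, neg_nonpos]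
      apply Real.log_nonneg
      by_contra! h
      exact hx ⟨(abs_lt.1 h).1.le, (abs_lt.1 h).2.le⟩
  rw [h2, lintegral_indicator measurableSet_Icc]
  refine lt_of_le_of_lt (lintegral_mono fun x => ?_) h1.2
  rw [Real.enorm_eq_ofReal_abs]
  exact ENNReal.ofReal_le_ofReal (le_abs_self _)

/-- Uniformity in the shift is the point. The modulus dominates the real part, whose density is
bounded by its peak value; Lebesgue measure is translation invariant, so `c` disappears. -/
lemma exists_lintegral_neg_log_norm_add_le {L : ℝ} (hL : 0 < L) :
    ∃ C : ℝ≥0∞, C < ∞ ∧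
      ∀ c : ℂ, ∫⁻ z, ENNReal.ofReal (-Real.log ‖z + c‖) ∂complexGaussian L ≤ C := by
  have hv : (L / 2).toNNReal ≠ 0 := by simpa using hL
  refine ⟨ENNReal.ofReal (√(2 * Real.pi * (L / 2).toNNReal))⁻¹ *
    ∫⁻ x : ℝ, ENNReal.ofReal (-Real.log |x|),
    ENNReal.mul_lt_top ENNReal.ofReal_lt_top lintegral_neg_log_abs_lt_top, fun c => ?_⟩
  have hm : Measurable fun x : ℝ => ENNReal.ofReal (-Real.log |x + c.re|) := by fun_prop
  calc ∫⁻ z, ENNReal.ofReal (-Real.log ‖z + c‖) ∂complexGaussian L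
      ≤ ∫⁻ z, ENNReal.ofReal (-Real.log |z.re + c.re|) ∂complexGaussian L := by
        refine lintegral_mono_ae ?_
        filter_upwards [ae_re_add_ne_zero_complexGaussian hL c] with z hz
        refine ENNReal.ofReal_le_ofReal (neg_le_neg (Real.log_le_log (abs_pos.2 hz) ?_))
        simpa using Complex.abs_re_le_norm (z + c)
    _ = ∫⁻ x, ENNReal.ofReal (-Real.log |x + c.re|) ∂gaussianReal 0 (L / 2).toNNReal := by
        rw [← map_re_complexGaussian, lintegral_map hm Complex.measurable_re]
    _ = ∫⁻ x, gaussianPDF 0 (L / 2).toNNReal x * ENNReal.ofReal (-Real.log |x + c.re|) := by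
        rw [gaussianReal_of_var_ne_zero _ hv,
          lintegral_withDensity_eq_lintegral_mul _ (by fun_prop) hm]
        rfl
    _ ≤ ∫⁻ x, ENNReal.ofReal (√(2 * Real.pi * (L / 2).toNNReal))⁻¹ *
          ENNReal.ofReal (-Real.log |x + c.re|) := by
        refine lintegral_mono fun x => mul_le_mul_left ?_ _
        rw [gaussianPDF_def]
        refine ENNReal.ofReal_le_ofReal ?_
        unfold gaussianPDFReal
        refine mul_le_of_le_one_right (by positivity) (Real.exp_le_one_iff.2 ?_)
        exact div_nonpos_of_nonpos_of_nonneg (neg_nonpos.2 (sq_nonneg _)) (by positivity)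
    _ = _ := by
        rw [lintegral_const_mul _ hm,
          lintegral_add_right_eq_self (fun x : ℝ => ENNReal.ofReal (-Real.log |x|)) c.re]

lemma ofReal_neg_log_norm_mul_add_le {α : ℂ} (hα : α ≠ 0) (β z : ℂ) :
    ENNReal.ofReal (-Real.log ‖α * z + β‖) ≤
      ENNReal.ofReal (-Real.log ‖α‖) + ENNReal.ofReal (-Real.log ‖z + β / α‖) := by
  have e : α * z + β = α * (z + β / α) := by field_simp
  by_cases h : z + β / α = 0
  · simp [e, h]
  · rw [e, norm_mul, Real.log_mul (norm_ne_zero_iff.2 hα) (norm_ne_zero_iff.2 h), neg_add]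
    exact ENNReal.ofReal_add_le

/-- A random variable is almost surely nonzero and its logarithm is bounded below in the mean. -/
structure NegLogFinite {X : Type*} [MeasurableSpace X] (ν : Measure X) (f : X → ℂ) : Prop where
  ne_zero : ∀ᵐ x ∂ν, f x ≠ 0
  lintegral_lt_top : ∫⁻ x, ENNReal.ofReal (-Real.log ‖f x‖) ∂ν < ∞

/-- Fubini: for fixed `x` factor out `α x`, leaving a Gaussian shifted by `β x / α x`. The uniform
bound makes the size of this shift irrelevant, so nothing beyond measurability is asked of `β`. -/
lemma NegLogFinite.mul_add_complexGaussian {X : Type*} [MeasurableSpace X] {ν : Measure X}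
    [IsProbabilityMeasure ν] {L : ℝ} (hL : 0 < L) {α β : X → ℂ} (hα : Measurable α)
    (hβ : Measurable β) (h : NegLogFinite ν α) :
    NegLogFinite (ν.prod (complexGaussian L)) fun p => α p.1 * p.2 + β p.1 := by
  have hm : Measurable fun p : X × ℂ => α p.1 * p.2 + β p.1 := by fun_prop
  constructor
  · refine (Measure.ae_prod_iff_ae_ae (hm (measurableSet_singleton (0 : ℂ))).compl).2 ?_
    filter_upwards [h.ne_zero] with x hx
    filter_upwards [ae_add_ne_zero_complexGaussian hL (β x / α x)] with z hz h0
    refine hz ?_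
    have h1 : α x * z + β x = 0 := h0
    field_simp
    linear_combination h1
  · obtain ⟨C, hC, hle⟩ := exists_lintegral_neg_log_norm_add_le hL
    rw [lintegral_prod _ (by fun_prop)]
    calc _ ≤ ∫⁻ x, (ENNReal.ofReal (-Real.log ‖α x‖) + C) ∂ν := by
          refine lintegral_mono_ae ?_
          filter_upwards [h.ne_zero] with x hx
          refine (lintegral_mono fun z => ofReal_neg_log_norm_mul_add_le hx (β x) z).trans ?_
          rw [lintegral_add_left measurable_const]
          rw [lintegral_const, measure_univ, mul_one]
          exact add_le_add le_rfl (hle _)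
      _ < ∞ := by
          rw [lintegral_add_right _ measurable_const]
          simpa using ⟨h.lintegral_lt_top, hC⟩

lemma NegLogFinite.of_measurePreserving {X Y : Type*} [MeasurableSpace X] [MeasurableSpace Y]
    {ν : Measure X} {ρ : Measure Y} {g : X → Y} (hg : MeasurePreserving g ν ρ) {f : Y → ℂ}
    (hf : Measurable f) (h : NegLogFinite ν fun x => f (g x)) : NegLogFinite ρ f := by
  constructor
  · rw [← hg.map_eq]
    exact (ae_map_iff hg.measurable.aemeasurable (hf (measurableSet_singleton 0)).compl).2 h.ne_zero
  · rw [← hg.lintegral_comp (by fun_prop)]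
    exact h.lintegral_lt_top

lemma NegLogFinite.comp_measurePreserving {X Y : Type*} [MeasurableSpace X] [MeasurableSpace Y]
    {ν : Measure X} {ρ : Measure Y} {g : X → Y} (hg : MeasurePreserving g ν ρ) {f : Y → ℂ}
    (hf : Measurable f) (h : NegLogFinite ρ f) : NegLogFinite ν fun x => f (g x) :=
  ⟨hg.quasiMeasurePreserving.ae h.ne_zero,
    (hg.lintegral_comp (f := fun y => ENNReal.ofReal (-Real.log ‖f y‖)) (by fun_prop)).trans_lt
      h.lintegral_lt_top⟩

/-! ### Log-integrability of a Gaussian determinant bordered by `b`. -/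

/-- Resampling one coordinate independently preserves a product measure. -/
lemma measurePreserving_update {ι : Type*} [Fintype ι] [DecidableEq ι] {X : ι → Type*}
    [∀ i, MeasurableSpace (X i)] (μ : ∀ i, Measure (X i)) [∀ i, IsProbabilityMeasure (μ i)]
    (i : ι) :
    MeasurePreserving (fun p : (∀ j, X j) × X i => Function.update p.1 i p.2)
      ((Measure.pi μ).prod (μ i)) (Measure.pi μ) := by
  have hm : Measurable fun p : (∀ j, X j) × X i => Function.update p.1 i p.2 := by
    refine measurable_pi_lambda _ fun j => ?_
    by_cases h : j = i
    · subst h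
      simpa using measurable_snd
    · simp only [Function.update_of_ne h]
      fun_prop
  refine ⟨hm, (Measure.pi_eq fun s hs => ?_).symm⟩
  rw [Measure.map_apply hm (MeasurableSet.univ_pi hs)]
  have : (fun p : (∀ j, X j) × X i => Function.update p.1 i p.2) ⁻¹' Set.univ.pi s =
      (Set.univ.pi (Function.update s i Set.univ)) ×ˢ s i := by
    ext p
    simp only [Set.mem_preimage, Set.mem_univ_pi, Set.mem_prod]
    constructor
    · intro h
      refine ⟨fun j => ?_, by simpa using h i⟩
      by_cases hj : j = i
      · subst hj; simp
      · simpa [hj] using h j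
    · rintro ⟨h1, h2⟩ j
      by_cases hj : j = i
      · subst hj; simpa using h2
      · simpa [hj] using h1 j
  rw [this, Measure.prod_prod, Measure.pi_pi, ← Finset.prod_erase_mul _ _ (Finset.mem_univ i),
    ← Finset.prod_erase_mul Finset.univ (fun j => μ j (s j)) (Finset.mem_univ i)]
  simp only [Function.update_self, measure_univ, mul_one]
  congr 1
  refine Finset.prod_congr rfl fun j hj => ?_
  rw [Function.update_of_ne (Finset.ne_of_mem_erase hj)]

/-- The determinant is affine in the last entry. -/
lemma det_eq_add_of_eq_off_last {n : ℕ} {N N' : Matrix (Fin (n + 1)) (Fin (n + 1)) ℂ}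
    (h : ∀ i j, ¬(i = Fin.last n ∧ j = Fin.last n) → N i j = N' i j) :
    N.det = (N'.submatrix Fin.castSucc Fin.castSucc).det *
      (N (Fin.last n) (Fin.last n) - N' (Fin.last n) (Fin.last n)) + N'.det := by
  -- The last rows differ by a multiple of a unit vector, so multilinearity leaves one cofactor.
  have e : N = N'.updateRow (Fin.last n) (N' (Fin.last n) +
      (N (Fin.last n) (Fin.last n) - N' (Fin.last n) (Fin.last n)) • Pi.single (Fin.last n) 1) := by
    ext i j
    by_cases hi : i = Fin.last n
    · subst hi
      by_cases hj : j = Fin.last n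
      · subst hj; simp
      · simp [hj, h _ _ (fun H => hj H.2)]
    · simp [hi, h _ _ (fun H => hi H.1)]
  conv_lhs => rw [e]
  rw [det_updateRow_add, det_updateRow_smul, updateRow_eq_self, ← adjugate_apply,
    adjugate_fin_succ_eq_det_submatrix]
  have : (Fin.last n).succAbove = Fin.castSucc := by ext; simp
  rw [this, Even.neg_one_pow ⟨_, rfl⟩]
  ring

/-- The square submatrix with columns `e` of the matrix with rows `b, x₁, …, x_K`. -/
def bordered {K NB : ℕ} (b : Fin NB → ℂ) (e : Fin (K + 1) → Fin NB) (x : Fin K → Fin NB → ℂ) :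
    Matrix (Fin (K + 1)) (Fin (K + 1)) ℂ :=
  Matrix.of fun i j => (Fin.cons b x : Fin (K + 1) → Fin NB → ℂ) i (e j)

lemma bordered_update {K NB : ℕ} (b : Fin NB → ℂ) (e : Fin (K + 1) → Fin NB)
    (x : Fin K → Fin NB → ℂ) (i : Fin K) (w : Fin NB → ℂ) :
    bordered b e (Function.update x i w) = (bordered b e x).updateRow i.succ (w ∘ e) := by
  ext r s
  by_cases hr : r = i.succ
  · subst hr
    simp [bordered]
  · simp [bordered, Fin.cons_update, hr]

/-- The leading principal minors of `bordered`. -/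
def leadingMinor {K NB : ℕ} (b : Fin NB → ℂ) (e : Fin (K + 1) → Fin NB) (k : ℕ)
    (hk : k + 1 ≤ K + 1) (x : Fin K → Fin NB → ℂ) : ℂ :=
  ((bordered b e x).submatrix (Fin.castLE hk) (Fin.castLE hk)).det

lemma measurable_bordered {K NB : ℕ} (b : Fin NB → ℂ) (e : Fin (K + 1) → Fin NB)
    (i j : Fin (K + 1)) : Measurable fun x => bordered b e x i j := by
  refine Fin.cases ?_ (fun i => ?_) i
  · simp [bordered]
  · simp only [bordered, of_apply, Fin.cons_succ]
    fun_prop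

lemma measurable_leadingMinor {K NB : ℕ} (b : Fin NB → ℂ) (e : Fin (K + 1) → Fin NB) (k : ℕ)
    (hk : k + 1 ≤ K + 1) : Measurable (leadingMinor b e k hk) := by
  unfold leadingMinor
  simp only [det_apply]
  refine Finset.measurable_sum _ fun σ _ => Measurable.const_smul ?_ _
  exact Finset.measurable_prod _ fun i _ =>
    measurable_bordered b e (Fin.castLE hk (σ i)) (Fin.castLE hk i)

/-- Row `0` of the bordered matrix is `b`, so the corner of the minor of size `k + 2` lies in the
row of user `k`. Injectivity of `e` makes `z` occur only there, and its cofactor is the preceding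
minor. -/
lemma leadingMinor_update {K NB : ℕ} (b : Fin NB → ℂ) {e : Fin (K + 1) → Fin NB}
    (he : Function.Injective e) (k : ℕ) (hk : k + 1 + 1 ≤ K + 1)
    (x : Fin K → Fin NB → ℂ) (y : Fin NB → ℂ) (z : ℂ) :
    leadingMinor b e (k + 1) hk
        (Function.update x ⟨k, by omega⟩ (Function.update y (e ⟨k + 1, by omega⟩) z)) =
      leadingMinor b e k (by omega) x * z + leadingMinor b e (k + 1) hk
        (Function.update x ⟨k, by omega⟩ (Function.update y (e ⟨k + 1, by omega⟩) 0)) := by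
  have hrow : ∀ r : Fin (k + 1 + 1), Fin.castLE hk r = (⟨k, by omega⟩ : Fin K).succ ↔
      r = Fin.last (k + 1) := fun r => by
    simp [Fin.ext_iff]
  have hcol : ∀ r : Fin (k + 1 + 1), e (Fin.castLE hk r) = e ⟨k + 1, by omega⟩ ↔
      r = Fin.last (k + 1) := fun r => by
    rw [he.eq_iff]
    simp [Fin.ext_iff]
  unfold leadingMinor
  rw [det_eq_add_of_eq_off_last (N' := (bordered b e (Function.update x ⟨k, by omega⟩
    (Function.update y (e ⟨k + 1, by omega⟩) 0))).submatrix (Fin.castLE hk) (Fin.castLE hk))]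
  · congr 2
    · congr 1
      ext r s
      have : (Fin.castLE hk r.castSucc) ≠ (⟨k, by omega⟩ : Fin K).succ := fun h =>
        (Fin.castSucc_lt_last r).ne ((hrow _).1 h)
      simp only [submatrix_apply, bordered_update, updateRow_ne this]
      rfl
    · have h1 := (hrow (Fin.last (k + 1))).2 rfl
      have h2 := (hcol (Fin.last (k + 1))).2 rfl
      simp only [submatrix_apply, bordered_update, h1, updateRow_self, Function.comp]
      rw [← h1, h2, Function.update_self, Function.update_self, sub_zero]
  · intro r s hrs
    simp only [submatrix_apply, bordered_update]
    by_cases hr : r = Fin.last (k + 1)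
    · have hs : e (Fin.castLE hk s) ≠ e ⟨k + 1, by omega⟩ := fun h => hrs ⟨hr, (hcol _).1 h⟩
      simp only [(hrow r).2 hr, updateRow_self, Function.comp, Function.update_of_ne hs]
    · simp only [updateRow_ne (fun h => hr ((hrow r).1 h))]

/-- The induction starts at the constant `b (e 0) ≠ 0`. Each step resamples the corner entry: the
minor becomes affine in a Gaussian independent of the rest, with the previous minor as slope. -/
lemma negLogFinite_leadingMinor {K NB : ℕ} {b : Fin NB → ℂ} {e : Fin (K + 1) → Fin NB}
    (he : Function.Injective e) (hb : b (e 0) ≠ 0) {Ld : Fin K → ℝ} (hLd : ∀ k, 0 < Ld k) (k : ℕ)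
    (hk : k + 1 ≤ K + 1) :
    NegLogFinite (Measure.pi fun i => complexGaussianVec NB (Ld i)) (leadingMinor b e k hk) := by
  induction k with
  | zero =>
    have h : leadingMinor b e 0 hk = fun _ => b (e 0) := by
      ext x
      simp [leadingMinor, bordered]
    rw [h]
    exact ⟨Filter.Eventually.of_forall fun _ => hb, by simp⟩
  | succ k ih =>
    have hm := measurable_leadingMinor b e (k + 1) hk
    have hk' : k + 1 ≤ K + 1 := by omega
    have hmk := measurable_leadingMinor b e k hk'
    let i : Fin K := ⟨k, by omega⟩
    let j : Fin NB := e ⟨k + 1, by omega⟩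
    set μ := Measure.pi fun i => complexGaussianVec NB (Ld i) with hμ
    have hU : MeasurePreserving (fun p : (Fin K → Fin NB → ℂ) × (Fin NB → ℂ) =>
        Function.update p.1 i p.2) (μ.prod (complexGaussianVec NB (Ld i))) μ :=
      measurePreserving_update (fun i => complexGaussianVec NB (Ld i)) i
    have hV : MeasurePreserving (fun p : (Fin NB → ℂ) × ℂ => Function.update p.1 j p.2)
        ((complexGaussianVec NB (Ld i)).prod (complexGaussian (Ld i)))
        (complexGaussianVec NB (Ld i)) :=
      measurePreserving_update (fun _ => complexGaussian (Ld i)) j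
    -- Resample one coordinate of a fresh row, then insert this row: the direct law is unchanged and
    -- the last factor is the independent corner entry.
    have hg : MeasurePreserving (fun p : ((Fin K → Fin NB → ℂ) × (Fin NB → ℂ)) × ℂ =>
        Function.update p.1.1 i (Function.update p.1.2 j p.2))
        ((μ.prod (complexGaussianVec NB (Ld i))).prod (complexGaussian (Ld i))) μ :=
      (hU.comp ((MeasurePreserving.id μ).prod hV)).comp
      (measurePreserving_prodAssoc μ (complexGaussianVec NB (Ld i)) (complexGaussian (Ld i)))
    have h0 : Measurable fun p : (Fin K → Fin NB → ℂ) × (Fin NB → ℂ) =>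
        leadingMinor b e (k + 1) hk (Function.update p.1 i (Function.update p.2 j 0)) := by
      have h1 : Measurable fun p : (Fin K → Fin NB → ℂ) × (Fin NB → ℂ) =>
          (p.1, Function.update p.2 j 0) :=
        measurable_fst.prodMk (measurable_update_left.comp measurable_snd)
      exact hm.comp (hU.measurable.comp h1)
    refine NegLogFinite.of_measurePreserving hg hm ?_
    have hα : NegLogFinite (μ.prod (complexGaussianVec NB (Ld i)))
        fun p => leadingMinor b e k hk' p.1 :=
      (ih hk').comp_measurePreserving measurePreserving_fst hmk
    have heq : (fun p : ((Fin K → Fin NB → ℂ) × (Fin NB → ℂ)) × ℂ => leadingMinor b e (k + 1) hk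
        (Function.update p.1.1 i (Function.update p.1.2 j p.2))) =
        fun p => leadingMinor b e k hk' p.1.1 * p.2 + leadingMinor b e (k + 1) hk
          (Function.update p.1.1 i (Function.update p.1.2 j 0)) :=
      funext fun p => leadingMinor_update b he k hk p.1.1 p.1.2 p.2
    rw [heq]
    exact hα.mul_add_complexGaussian (hLd i) (hmk.comp measurable_fst) h0

/-! ### Calculus of logarithmic moments. -/

/-- A random variable with a finite first logarithmic moment. -/
structure LogMoment {X : Type*} [MeasurableSpace X] (ν : Measure X) (f : X → ℂ) : Prop where
  measurable : Measurable f
  integrable : Integrable (fun x => Real.log (1 + ‖f x‖)) ν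

namespace LogMoment

variable {X : Type*} [MeasurableSpace X] {ν : Measure X} {f g : X → ℂ}

lemma log_nonneg (z : ℂ) : 0 ≤ Real.log (1 + ‖z‖) :=
  Real.log_nonneg (by linarith [norm_nonneg z])

lemma of_le (hf : Measurable f) {φ : X → ℝ} (hφ : Integrable φ ν)
    (h : ∀ x, Real.log (1 + ‖f x‖) ≤ φ x) : LogMoment ν f :=
  ⟨hf, hφ.mono' (Measurable.aestronglyMeasurable (by fun_prop)) (Filter.Eventually.of_forall fun x => by
    rw [Real.norm_of_nonneg (log_nonneg _)]; exact h x)⟩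

lemma of_integrable_norm (hf : Measurable f) (h : Integrable (fun x => ‖f x‖) ν) :
    LogMoment ν f :=
  of_le hf h fun x => by
    have := Real.log_le_sub_one_of_pos (x := 1 + ‖f x‖) (by positivity)
    linarith

/-- `1 + ‖f + g‖ ≤ (1 + ‖f‖) * (1 + ‖g‖)`. The same majorant serves products, so the class is closed
under polynomials without any independence. -/
lemma add (hf : LogMoment ν f) (hg : LogMoment ν g) : LogMoment ν fun x => f x + g x :=
  of_le (hf.measurable.add hg.measurable) (hf.integrable.add hg.integrable) fun x => by
    simp only [Pi.add_apply]
    rw [← Real.log_mul (by positivity) (by positivity)]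
    refine Real.log_le_log (by positivity) ?_
    nlinarith [norm_add_le (f x) (g x), norm_nonneg (f x), norm_nonneg (g x),
      mul_nonneg (norm_nonneg (f x)) (norm_nonneg (g x))]

lemma mul (hf : LogMoment ν f) (hg : LogMoment ν g) : LogMoment ν fun x => f x * g x :=
  of_le (hf.measurable.mul hg.measurable) (hf.integrable.add hg.integrable) fun x => by
    simp only [Pi.add_apply]
    rw [← Real.log_mul (by positivity) (by positivity), norm_mul]
    refine Real.log_le_log (by positivity) ?_
    nlinarith [norm_nonneg (f x), norm_nonneg (g x)]

lemma const [IsFiniteMeasure ν] (c : ℂ) : LogMoment ν fun _ => c :=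
  ⟨measurable_const, integrable_const _⟩

lemma star (hf : LogMoment ν f) : LogMoment ν fun x => Star.star (f x) :=
  ⟨continuous_star.measurable.comp hf.measurable, by simpa using hf.integrable⟩

/-- `log (1 + 1 / ‖f‖) = log (1 + ‖f‖) - log ‖f‖` off the zeros of `f`; at a zero the conventions
for `0⁻¹` and `log 0` make both sides vanish. -/
lemma inv (hf : LogMoment ν f) (h : Integrable (fun x => Real.log ‖f x‖) ν) :
    LogMoment ν fun x => (f x)⁻¹ :=
  of_le hf.measurable.inv (hf.integrable.sub h) fun x => by
    by_cases h0 : f x = 0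
    · simp [h0]
    · have : 0 < ‖f x‖ := norm_pos_iff.2 h0
      simp only [Pi.sub_apply]
      rw [← Real.log_div (by positivity) (by positivity), norm_inv]
      refine le_of_eq (congrArg _ ?_)
      field_simp
      ring

lemma sum [IsFiniteMeasure ν] {ι : Type*} (s : Finset ι) {f : ι → X → ℂ}
    (hf : ∀ i ∈ s, LogMoment ν (f i)) : LogMoment ν fun x => ∑ i ∈ s, f i x := by
  classical
  induction s using Finset.induction_on with
  | empty => simpa using const 0
  | insert i s hi ih =>
    simp only [Finset.sum_insert hi]
    exact (hf i (by simp)).add (ih fun j hj => hf j (by simp [hj]))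

lemma prod [IsFiniteMeasure ν] {ι : Type*} (s : Finset ι) {f : ι → X → ℂ}
    (hf : ∀ i ∈ s, LogMoment ν (f i)) : LogMoment ν fun x => ∏ i ∈ s, f i x := by
  classical
  induction s using Finset.induction_on with
  | empty => simpa using const 1
  | insert i s hi ih =>
    simp only [Finset.prod_insert hi]
    exact (hf i (by simp)).mul (ih fun j hj => hf j (by simp [hj]))

lemma det [IsFiniteMeasure ν] {n : Type*} [Fintype n] [DecidableEq n] {A : X → Matrix n n ℂ}
    (hA : ∀ i j, LogMoment ν fun x => A x i j) : LogMoment ν fun x => (A x).det := by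
  simp only [det_apply']
  exact sum _ fun σ _ => (const _).mul (prod _ fun i _ => hA _ _)

lemma adjugate [IsFiniteMeasure ν] {n : Type*} [Fintype n] [DecidableEq n] {A : X → Matrix n n ℂ}
    (hA : ∀ i j, LogMoment ν fun x => A x i j) (i j : n) :
    LogMoment ν fun x => (A x).adjugate i j := by
  simp only [adjugate_apply]
  refine det fun r s => ?_
  by_cases h : r = j
  · subst h
    simpa using const _
  · simpa [updateRow_ne h] using hA r s

lemma matrix_inv [IsFiniteMeasure ν] {n : Type*} [Fintype n] [DecidableEq n]
    {A : X → Matrix n n ℂ} (hA : ∀ i j, LogMoment ν fun x => A x i j)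
    (h : Integrable (fun x => Real.log ‖(A x).det‖) ν) (i j : n) :
    LogMoment ν fun x => (A x)⁻¹ i j := by
  simp only [inv_def, Ring.inverse_eq_inv', Matrix.smul_apply, smul_eq_mul]
  exact ((det hA).inv h).mul (adjugate hA i j)

lemma integrable_log_norm (hf : LogMoment ν f) (h : NegLogFinite ν f) :
    Integrable (fun x => Real.log ‖f x‖) ν := by
  have h1 : Integrable (fun x => max (-Real.log ‖f x‖) 0) ν := by
    have := hf.measurable
    refine ⟨Measurable.aestronglyMeasurable (by fun_prop), ?_⟩
    refine lt_of_le_of_lt (lintegral_mono fun x => ?_) h.lintegral_lt_top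
    rw [Real.enorm_eq_ofReal (le_max_right _ _)]
    simp [ENNReal.ofReal_max]
  have := hf.measurable
  refine (h1.add hf.integrable).mono' (Measurable.aestronglyMeasurable (by fun_prop)) ?_
  filter_upwards [h.ne_zero] with x hx
  have h2 := le_max_left (-Real.log ‖f x‖) 0
  have h3 := le_max_right (-Real.log ‖f x‖) 0
  have h4 : Real.log ‖f x‖ ≤ Real.log (1 + ‖f x‖) :=
    Real.log_le_log (norm_pos_iff.2 hx) (by linarith)
  have h5 := log_nonneg (f x)
  simp only [Pi.add_apply, Real.norm_eq_abs, abs_le]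
  constructor <;> linarith

end LogMoment

/-! ### The mitigation term as a least-norm problem. -/

lemma star_dotProduct_self {n : Type*} [Fintype n] (x : n → ℂ) :
    star x ⬝ᵥ x = ((∑ i, ‖x i‖ ^ 2 : ℝ) : ℂ) := by
  simp [dotProduct, Complex.conj_mul']

lemma norm_star_dotProduct_sq_le {n : Type*} [Fintype n] (x y : n → ℂ) :
    ‖star x ⬝ᵥ y‖ ^ 2 ≤ (∑ i, ‖x i‖ ^ 2) * ∑ i, ‖y i‖ ^ 2 := by
  have h : ‖star x ⬝ᵥ y‖ ≤ ∑ i, ‖x i‖ * ‖y i‖ :=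
    (norm_sum_le _ _).trans_eq (by simp)
  exact (pow_le_pow_left₀ (norm_nonneg _) h 2).trans (Finset.sum_mul_sq_le_sq_mul_sq _ _ _)

lemma projPerp_mulVec {n : ℕ} (b y : Fin n → ℂ) :
    projPerp b *ᵥ y = y - (star b ⬝ᵥ y) • b := by
  ext i
  simp [projPerp, sub_mulVec, vecMulVec_mulVec]

lemma projPerp_conjTranspose {n : ℕ} (b : Fin n → ℂ) : (projPerp b)ᴴ = projPerp b := by
  simp [projPerp, conjTranspose_vecMulVec]

lemma star_dotProduct_projPerp_mulVec {n : ℕ} {b : Fin n → ℂ} (hb : star b ⬝ᵥ b = 1)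
    (y : Fin n → ℂ) : star b ⬝ᵥ (projPerp b *ᵥ y) = 0 := by
  rw [projPerp_mulVec, dotProduct_sub, dotProduct_smul, hb]
  simp

lemma projPerp_mul_self {n : ℕ} {b : Fin n → ℂ} (hb : star b ⬝ᵥ b = 1) :
    projPerp b * projPerp b = projPerp b := by
  refine ext_of_mulVec_single fun i => ?_
  rw [← mulVec_mulVec, projPerp_mulVec b (projPerp b *ᵥ _), star_dotProduct_projPerp_mulVec hb]
  simp

lemma Cs_conjTranspose {K NB : ℕ} (b : Fin NB → ℂ) (Hd : Matrix (Fin K) (Fin NB) ℂ) :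
    (Cs b Hd)ᴴ = Cs b Hd := by
  simp [Cs, conjTranspose_mul, projPerp_conjTranspose, Matrix.mul_assoc]

/-- The vector `D_s θ̄`. -/
def effective {K NB NR : ℕ} (b : Fin NB → ℂ) (Hd : Matrix (Fin K) (Fin NB) ℂ)
    (Hc : Matrix (Fin K) (Fin NR) ℂ) (θ : Fin NR → ℂ) : Fin K → ℂ :=
  Hc *ᵥ θ + Hd *ᵥ b

lemma Ds_mulVec_extPhases {K NB NR : ℕ} (b : Fin NB → ℂ) (Hd : Matrix (Fin K) (Fin NB) ℂ)
    (Hc : Matrix (Fin K) (Fin NR) ℂ) (θ : Fin NR → ℂ) :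
    Ds b Hd Hc *ᵥ extPhases θ = effective b Hd Hc θ := by
  ext k
  simp [Ds, extPhases, effective, mulVec, dotProduct]

lemma mitigation_eq {K NB NR : ℕ} (b : Fin NB → ℂ) (Hd : Matrix (Fin K) (Fin NB) ℂ)
    (Hc : Matrix (Fin K) (Fin NR) ℂ) (θ : Fin NR → ℂ) :
    mitigation b Hd Hc θ =
      (star (effective b Hd Hc θ) ⬝ᵥ ((Cs b Hd)⁻¹ *ᵥ effective b Hd Hc θ)).re := by
  rw [mitigation, ← Ds_mulVec_extPhases, star_mulVec, ← mulVec_mulVec, ← mulVec_mulVec,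
    dotProduct_mulVec]

/-- The vector orthogonal to `b` of least norm that `H_d` maps to `v`. -/
def leastNormSolution {K NB : ℕ} (b : Fin NB → ℂ) (Hd : Matrix (Fin K) (Fin NB) ℂ)
    (v : Fin K → ℂ) : Fin NB → ℂ :=
  projPerp b *ᵥ (Hdᴴ *ᵥ ((Cs b Hd)⁻¹ *ᵥ v))

section

variable {K NB NR : ℕ} {b : Fin NB → ℂ} {Hd : Matrix (Fin K) (Fin NB) ℂ}

lemma mulVec_leastNormSolution (hC : IsUnit (Cs b Hd).det) (v : Fin K → ℂ) :
    Hd *ᵥ leastNormSolution b Hd v = v := by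
  rw [leastNormSolution, mulVec_mulVec, mulVec_mulVec, ← Cs, mulVec_mulVec,
    mul_nonsing_inv _ hC, one_mulVec]

/-- The least-norm solution lies in the range of `projPerp b * Hdᴴ`, so its pairing with a feasible
`y` sees only `Hd *ᵥ y = v`. -/
lemma star_leastNormSolution_dotProduct (v : Fin K → ℂ) {y : Fin NB → ℂ}
    (hy : Hd *ᵥ y = v) (hby : star b ⬝ᵥ y = 0) :
    star (leastNormSolution b Hd v) ⬝ᵥ y = star v ⬝ᵥ ((Cs b Hd)⁻¹ *ᵥ v) := by
  have hPy : projPerp b *ᵥ y = y := by rw [projPerp_mulVec, hby]; simp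
  rw [leastNormSolution, star_mulVec, star_mulVec, star_mulVec, projPerp_conjTranspose,
    conjTranspose_conjTranspose, conjTranspose_nonsing_inv, Cs_conjTranspose,
    ← dotProduct_mulVec, hPy, ← dotProduct_mulVec, hy, ← dotProduct_mulVec]

lemma star_dotProduct_leastNormSolution (hb : star b ⬝ᵥ b = 1) (v : Fin K → ℂ) :
    star b ⬝ᵥ leastNormSolution b Hd v = 0 :=
  star_dotProduct_projPerp_mulVec hb _

lemma mitigation_eq_sum (hb : star b ⬝ᵥ b = 1) (hC : IsUnit (Cs b Hd).det)
    (Hc : Matrix (Fin K) (Fin NR) ℂ) (θ : Fin NR → ℂ) :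
    mitigation b Hd Hc θ = ∑ n, ‖leastNormSolution b Hd (effective b Hd Hc θ) n‖ ^ 2 := by
  rw [mitigation_eq, ← star_leastNormSolution_dotProduct _ (mulVec_leastNormSolution hC _)
    (star_dotProduct_leastNormSolution hb _), star_dotProduct_self, Complex.ofReal_re]

lemma mitigation_nonneg (hb : star b ⬝ᵥ b = 1) (hC : IsUnit (Cs b Hd).det)
    (Hc : Matrix (Fin K) (Fin NR) ℂ) (θ : Fin NR → ℂ) : 0 ≤ mitigation b Hd Hc θ := by
  rw [mitigation_eq_sum hb hC]
  positivity

/-- Minimality of the norm: Cauchy–Schwarz for the pairing above gives `M ^ 2 ≤ M * ‖y‖ ^ 2`, and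
`M` cancels unless it is zero. -/
lemma mitigation_le_sum (hb : star b ⬝ᵥ b = 1) (hC : IsUnit (Cs b Hd).det)
    (Hc : Matrix (Fin K) (Fin NR) ℂ) (θ : Fin NR → ℂ) {y : Fin NB → ℂ}
    (hy : Hd *ᵥ y = effective b Hd Hc θ) (hby : star b ⬝ᵥ y = 0) :
    mitigation b Hd Hc θ ≤ ∑ n, ‖y n‖ ^ 2 := by
  have h0 := mitigation_nonneg hb hC Hc θ
  have h1 : mitigation b Hd Hc θ ^ 2 ≤ mitigation b Hd Hc θ * ∑ n, ‖y n‖ ^ 2 := by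
    calc mitigation b Hd Hc θ ^ 2
        ≤ ‖star (leastNormSolution b Hd (effective b Hd Hc θ)) ⬝ᵥ y‖ ^ 2 := by
          rw [star_leastNormSolution_dotProduct _ hy hby]
          refine pow_le_pow_left₀ h0 ?_ 2
          rw [mitigation_eq]
          exact Complex.re_le_norm _
      _ ≤ _ := by
          refine (norm_star_dotProduct_sq_le _ _).trans_eq ?_
          rw [← mitigation_eq_sum hb hC]
  rcases h0.eq_or_lt with h | h
  · rw [← h]; positivity
  · rw [sq] at h1
    exact le_of_mul_le_mul_left h1 h

/-- Subtracting `b` from the least-norm solution `w` removes `H_d b` from its image and, as `w ⟂ b`,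
adds exactly `1` to its squared norm. This accounts for the `1 +`; the rest is Cauchy–Schwarz. -/
lemma norm_star_dotProduct_sq_le_mitigation (hb : star b ⬝ᵥ b = 1) (hC : IsUnit (Cs b Hd).det)
    (Hc : Matrix (Fin K) (Fin NR) ℂ) (θ : Fin NR → ℂ) (c : Fin K → ℂ) :
    ‖star c ⬝ᵥ (Hc *ᵥ θ)‖ ^ 2 ≤
      (∑ n, ‖(Hdᴴ *ᵥ c) n‖ ^ 2) * (1 + mitigation b Hd Hc θ) := by
  set w := leastNormSolution b Hd (effective b Hd Hc θ) with hw
  have hbw : star b ⬝ᵥ w = 0 := star_dotProduct_leastNormSolution hb _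
  have hwb : star w ⬝ᵥ b = 0 := by
    have := congrArg star hbw
    rwa [star_zero, star_dotProduct, star_star] at this
  have h1 : Hd *ᵥ (w - b) = Hc *ᵥ θ := by
    rw [mulVec_sub, hw, mulVec_leastNormSolution hC, effective, add_sub_cancel_right]
  have h2 : ∑ n, ‖(w - b) n‖ ^ 2 = 1 + mitigation b Hd Hc θ := by
    rw [← Complex.ofReal_inj, ← star_dotProduct_self, star_sub, sub_dotProduct, dotProduct_sub,
      dotProduct_sub, hb, hbw, hwb, star_dotProduct_self, mitigation_eq_sum hb hC]
    push_cast
    ring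
  rw [← h2]
  refine le_trans (le_of_eq ?_) (norm_star_dotProduct_sq_le _ _)
  rw [star_mulVec, conjTranspose_conjTranspose, ← dotProduct_mulVec, h1]

end

section

variable {K NB NR : ℕ} {b : Fin NB → ℂ} {e : Fin (K + 1) → Fin NB} {x : Fin K → Fin NB → ℂ}

open scoped ComplexOrder in
-- `C_s` is the Gram matrix of `H_d` times the projector. A kernel vector would make a combination
-- of the channels a multiple of `b`, hence the rows of the bordered matrix dependent.
lemma isUnit_det_Cs (hb : star b ⬝ᵥ b = 1) (h : (bordered b e x).det ≠ 0) :
    IsUnit (Cs b (stack x)).det := by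
  rw [isUnit_iff_ne_zero]
  intro h0
  obtain ⟨c, hc, hCc⟩ := exists_mulVec_eq_zero_iff.2 h0
  have hG : Cs b (stack x) = stack x * projPerp b * (stack x * projPerp b)ᴴ := by
    rw [conjTranspose_mul, projPerp_conjTranspose, Matrix.mul_assoc, ← Matrix.mul_assoc _ _ (_ᴴ),
      projPerp_mul_self hb, Cs, Matrix.mul_assoc]
  rw [hG, self_mul_conjTranspose_mulVec_eq_zero, conjTranspose_mul, projPerp_conjTranspose,
    ← mulVec_mulVec, projPerp_mulVec, sub_eq_zero] at hCc
  have h1 : (Fin.cons (-(star b ⬝ᵥ ((stack x)ᴴ *ᵥ c))) c : Fin (K + 1) → ℂ) ᵥ*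
      bordered b e x = 0 := by
    ext j
    have h2 := congrFun hCc (e j)
    simp only [mulVec, dotProduct, stack, conjTranspose_apply, of_apply, Pi.star_apply, star_star,
      Pi.smul_apply, smul_eq_mul] at h2
    simp only [vecMul, dotProduct, Fin.sum_univ_succ, bordered, of_apply, Fin.cons_zero,
      Fin.cons_succ, Pi.zero_apply, mulVec, stack, conjTranspose_apply, Pi.star_apply, star_star]
    rw [neg_mul, ← h2, neg_add_eq_zero]
    exact Finset.sum_congr rfl fun i _ => mul_comm _ _
  have h3 := eq_zero_of_vecMul_eq_zero h h1
  exact hc (funext fun k => by simpa using congrFun h3 k.succ)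

/-- A vector supported on the columns `e` with `H_d y = v + H_d b` and `bᴴ y = 0`. -/
def supportedSolution (b : Fin NB → ℂ) (e : Fin (K + 1) → Fin NB) (x : Fin K → Fin NB → ℂ)
    (v : Fin K → ℂ) (n : Fin NB) : ℂ :=
  (∑ j, if e j = n then
    star (∑ i, (bordered b e x)⁻¹ j i * (Fin.cons (-1) (star v) : Fin (K + 1) → ℂ) i) else 0) + b n

/-- The part supported on the columns `e` solves the bordered system with right side `(-1, v)`.
Adding `b` turns `-1` into `-1 + ‖b‖ ^ 2 = 0` and `v` into `v + H_d b`. -/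
lemma sum_mul_supportedSolution (v : Fin K → ℂ) (h : (bordered b e x).det ≠ 0)
    (i : Fin (K + 1)) :
    ∑ n, star ((Fin.cons b x : Fin (K + 1) → Fin NB → ℂ) i n) * supportedSolution b e x v n =
      (Fin.cons (-1) v : Fin (K + 1) → ℂ) i +
        ∑ n, star ((Fin.cons b x : Fin (K + 1) → Fin NB → ℂ) i n) * b n := by
  have h1 : bordered b e x *ᵥ ((bordered b e x)⁻¹ *ᵥ (Fin.cons (-1) (star v))) =
      Fin.cons (-1) (star v) := by
    rw [mulVec_mulVec, mul_nonsing_inv _ (isUnit_iff_ne_zero.2 h), one_mulVec]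
  have h2 := congrArg star (congrFun h1 i)
  have h3 : star ((Fin.cons (-1) (star v) : Fin (K + 1) → ℂ) i) =
      (Fin.cons (-1) v : Fin (K + 1) → ℂ) i := by
    refine Fin.cases ?_ (fun i => ?_) i <;> simp
  rw [h3] at h2
  simp only [supportedSolution, mul_add, Finset.sum_add_distrib]
  rw [← h2]
  congr 1
  simp only [Finset.mul_sum]
  rw [Finset.sum_comm]
  simp [mulVec, dotProduct, bordered]

lemma mitigation_le_supportedSolution (hb : star b ⬝ᵥ b = 1) (h : (bordered b e x).det ≠ 0)
    (Hc : Matrix (Fin K) (Fin NR) ℂ) (θ : Fin NR → ℂ) :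
    mitigation b (stack x) Hc θ ≤ ∑ n, ‖supportedSolution b e x (Hc *ᵥ θ) n‖ ^ 2 := by
  refine mitigation_le_sum hb (isUnit_det_Cs hb h) _ _ ?_ ?_
  · ext k
    have := sum_mul_supportedSolution (Hc *ᵥ θ) h k.succ
    simpa [mulVec, dotProduct, stack, effective] using this
  · have := sum_mul_supportedSolution (Hc *ᵥ θ) h 0
    have hb' : ∑ n, star (b n) * b n = 1 := hb
    simp only [Fin.cons_zero, hb'] at this
    simpa [dotProduct] using this

end

/-! ### Cascaded channels, aligned phases and concavity. -/

lemma cascaded_apply {NR : ℕ} (NB : ℕ) (LG : ℝ) (a h : Fin NR → ℂ) (n : Fin NR) :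
    cascaded NB LG a h n = (√(LG * NB) : ℂ) * (star (a n) * h n) := by
  simp [cascaded, vecMul_diagonal, mul_comm]

lemma norm_cascaded_apply {NR : ℕ} (NB : ℕ) (LG : ℝ) {a : Fin NR → ℂ} (ha : ∀ n, ‖a n‖ = 1)
    (h : Fin NR → ℂ) (n : Fin NR) : ‖cascaded NB LG a h n‖ = √(LG * NB) * ‖h n‖ := by
  rw [cascaded_apply, norm_mul, norm_mul, norm_star, ha, one_mul, Complex.norm_real,
    Real.norm_of_nonneg (Real.sqrt_nonneg _)]

lemma norm_alignedPhases_apply {n : ℕ} (h : Fin n → ℂ) (i : Fin n) :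
    ‖alignedPhases h i‖ = 1 := by
  rw [alignedPhases, mul_comm, Complex.norm_exp_ofReal_mul_I]

lemma star_mul_alignedPhases {n : ℕ} (h : Fin n → ℂ) (i : Fin n) :
    star (h i) * alignedPhases h i = (‖h i‖ : ℂ) := by
  have h1 := Complex.norm_mul_exp_arg_mul_I (h i)
  have h2 : Complex.exp (Complex.arg (h i) * Complex.I) = alignedPhases h i := by
    rw [alignedPhases, mul_comm]
  rw [h2] at h1
  have h3 : star (alignedPhases h i) * alignedPhases h i = 1 := by
    rw [Complex.star_def, Complex.conj_mul', norm_alignedPhases_apply]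
    simp
  conv_lhs => rw [← h1]
  rw [star_mul', mul_assoc, h3, mul_one]
  exact Complex.conj_ofReal _

lemma norm_star_dotProduct_alignedPhases {n : ℕ} (h : Fin n → ℂ) :
    ‖star h ⬝ᵥ alignedPhases h‖ = ∑ i, ‖h i‖ := by
  simp only [dotProduct, Pi.star_apply, star_mul_alignedPhases]
  rw [← Complex.ofReal_sum, Complex.norm_real, Real.norm_of_nonneg (by positivity)]

/-- Weighted concavity of the logarithm. -/
lemma log_sum_add_le_log_sum_mul {ι : Type*} {t : Finset ι} (ht : t.Nonempty) {s x : ι → ℝ}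
    (hs : ∀ i ∈ t, 0 < s i) (hx : ∀ i ∈ t, 0 < x i) :
    Real.log (∑ i ∈ t, s i) + ∑ i ∈ t, s i / (∑ j ∈ t, s j) * Real.log (x i) ≤
      Real.log (∑ i ∈ t, s i * x i) := by
  have hS : 0 < ∑ i ∈ t, s i := Finset.sum_pos hs ht
  have h := strictConcaveOn_log_Ioi.concaveOn.le_map_sum (t := t)
    (w := fun i => s i / ∑ j ∈ t, s j) (p := x) (fun i hi => (div_pos (hs i hi) hS).le)
    (by rw [← Finset.sum_div, div_self hS.ne']) hx
  simp only [smul_eq_mul] at h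
  have hx' : 0 < ∑ i ∈ t, s i / (∑ j ∈ t, s j) * x i :=
    Finset.sum_pos (fun i hi => mul_pos (div_pos (hs i hi) hS) (hx i hi)) ht
  have h2 : ∑ i ∈ t, s i * x i = (∑ i ∈ t, s i) * ∑ i ∈ t, s i / (∑ j ∈ t, s j) * x i := by
    rw [Finset.mul_sum]
    refine Finset.sum_congr rfl fun i _ => ?_
    field_simp
  rw [h2, Real.log_mul hS.ne' hx'.ne']
  linarith

lemma measurePreserving_eval_complexGaussianVec (n : ℕ) (L : ℝ) (i : Fin n) :
    MeasurePreserving (fun h : Fin n → ℂ => h i) (complexGaussianVec n L) (complexGaussian L) :=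
  measurePreserving_eval (fun _ => complexGaussian L) i

lemma integral_comp_measurePreserving {X Y : Type*} [MeasurableSpace X] [MeasurableSpace Y]
    {μ : Measure X} {ν : Measure Y} {g : X → Y} (hg : MeasurePreserving g μ ν) {f : Y → ℝ}
    (hf : Measurable f) : ∫ x, f (g x) ∂μ = ∫ y, f y ∂ν := by
  rw [← hg.map_eq, integral_map hg.measurable.aemeasurable hf.aestronglyMeasurable]

/-! ### The weak user's amplitude sum. -/

section amplitude

variable {n : ℕ} {L : ℝ}

lemma ae_ne_zero_complexGaussian (hL : 0 < L) : ∀ᵐ z ∂complexGaussian L, z ≠ 0 := by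
  simpa using ae_add_ne_zero_complexGaussian hL 0

lemma ae_ne_zero_complexGaussianVec (n : ℕ) (hL : 0 < L) :
    ∀ᵐ h ∂complexGaussianVec n L, ∀ i, h i ≠ 0 :=
  ae_all_iff.2 fun i => (measurePreserving_eval_complexGaussianVec n L i).quasiMeasurePreserving.ae
    (ae_ne_zero_complexGaussian hL)

lemma integrable_norm_apply_vec (hL : 0 < L) (i : Fin n) :
    Integrable (fun h => ‖h i‖) (complexGaussianVec n L) :=
  (measurePreserving_eval_complexGaussianVec n L i).integrable_comp_of_integrable
    (integrable_norm_complexGaussian hL)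

lemma integrable_sum_norm (n : ℕ) (hL : 0 < L) :
    Integrable (fun h => ∑ i, ‖h i‖) (complexGaussianVec n L) :=
  integrable_finsetSum _ fun i _ => integrable_norm_apply_vec hL i

lemma integral_sum_norm (n : ℕ) (hL : 0 < L) :
    ∫ h, ∑ i, ‖h i‖ ∂complexGaussianVec n L = n * (√(Real.pi * L) / 2) := by
  rw [integral_finsetSum _ fun i _ => (integrable_norm_apply_vec hL i)]
  have h : ∀ i : Fin n, ∫ h, ‖h i‖ ∂complexGaussianVec n L = √(Real.pi * L) / 2 := fun i =>
    (integral_comp_measurePreserving (measurePreserving_eval_complexGaussianVec n L i)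
      measurable_norm).trans (integral_norm_complexGaussian hL)
  simp [h]

/-- The tangent line of the logarithm at the mean of the sum: a pointwise form of Jensen that also
supplies an integrable majorant. -/
lemma log_sum_norm_le (hn : 1 ≤ n) (hL : 0 < L) {h : Fin n → ℂ} (hh : ∀ i, h i ≠ 0) :
    Real.log (∑ i, ‖h i‖) ≤ Real.log (n * (√(Real.pi * L) / 2)) +
      ((∑ i, ‖h i‖) / (n * (√(Real.pi * L) / 2)) - 1) := by
  have : Nonempty (Fin n) := ⟨⟨0, hn⟩⟩
  have hn' : (0 : ℝ) < n := by exact_mod_cast hn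
  have hm : 0 < n * (√(Real.pi * L) / 2) := by have := Real.pi_pos; positivity
  have hS : 0 < ∑ i, ‖h i‖ :=
    Finset.sum_pos (fun i _ => norm_pos_iff.2 (hh i)) Finset.univ_nonempty
  have := Real.log_le_sub_one_of_pos (div_pos hS hm)
  rw [Real.log_div hS.ne' hm.ne'] at this
  linarith

lemma le_log_sum_norm (hn : 1 ≤ n) {h : Fin n → ℂ} (hh : ∀ i, h i ≠ 0) :
    Real.log n + ∑ i, 1 / (2 * n : ℝ) * Real.log (‖h i‖ ^ 2) ≤ Real.log (∑ i, ‖h i‖) := by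
  have : Nonempty (Fin n) := ⟨⟨0, hn⟩⟩
  have h1 := log_sum_add_le_log_sum_mul (Finset.univ_nonempty (α := Fin n)) (s := fun _ => 1)
    (x := fun i => ‖h i‖) (fun _ _ => one_pos) fun i _ => norm_pos_iff.2 (hh i)
  simp only [Finset.sum_const, Finset.card_univ, Fintype.card_fin, nsmul_eq_mul, mul_one,
    one_mul] at h1
  refine le_trans (le_of_eq ?_) h1
  congr 1
  refine Finset.sum_congr rfl fun i _ => ?_
  rw [Real.log_pow]
  push_cast
  field_simp

lemma integrable_log_norm_sq_vec (hL : 0 < L) (i : Fin n) :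
    Integrable (fun h => Real.log (‖h i‖ ^ 2)) (complexGaussianVec n L) :=
  (measurePreserving_eval_complexGaussianVec n L i).integrable_comp_of_integrable
    (integrable_log_norm_sq_complexGaussian hL)

lemma integrable_log_sum_norm (hn : 1 ≤ n) (hL : 0 < L) :
    Integrable (fun h => Real.log (∑ i, ‖h i‖)) (complexGaussianVec n L) := by
  refine integrable_of_le_of_le (Measurable.aestronglyMeasurable (by fun_prop))
    (g₁ := fun h => Real.log n + ∑ i, 1 / (2 * n : ℝ) * Real.log (‖h i‖ ^ 2))
    (g₂ := fun h => Real.log (n * (√(Real.pi * L) / 2)) +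
      ((∑ i, ‖h i‖) / (n * (√(Real.pi * L) / 2)) - 1)) ?_ ?_ ?_ ?_
  · filter_upwards [ae_ne_zero_complexGaussianVec n hL] with h hh using le_log_sum_norm hn hh
  · filter_upwards [ae_ne_zero_complexGaussianVec n hL] with h hh using log_sum_norm_le hn hL hh
  · exact (integrable_const _).add (integrable_finsetSum _ fun i _ =>
      (integrable_log_norm_sq_vec hL i).const_mul _)
  · exact (integrable_const _).add (((integrable_sum_norm n hL).div_const _).sub
      (integrable_const _))

lemma integral_log_sum_norm_le (hn : 1 ≤ n) (hL : 0 < L) :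
    ∫ h, Real.log (∑ i, ‖h i‖) ∂complexGaussianVec n L ≤
      Real.log (n * (√(Real.pi * L) / 2)) := by
  have hn' : (0 : ℝ) < n := by exact_mod_cast hn
  have hm : 0 < n * (√(Real.pi * L) / 2) := by have := Real.pi_pos; positivity
  have hi := ((integrable_sum_norm n hL).div_const (n * (√(Real.pi * L) / 2)))
  refine (integral_mono_ae (integrable_log_sum_norm hn hL)
    ((integrable_const (Real.log (n * (√(Real.pi * L) / 2)))).add
      (hi.sub (integrable_const 1))) ?_).trans (le_of_eq ?_)
  · filter_upwards [ae_ne_zero_complexGaussianVec n hL] with h hh using log_sum_norm_le hn hL hh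
  · rw [integral_add' (integrable_const _) (hi.sub (integrable_const 1)),
      integral_sub' hi (integrable_const 1), integral_div, integral_sum_norm n hL, div_self hm.ne']
    simp

lemma le_integral_log_sum_norm (hn : 1 ≤ n) (hL : 0 < L) :
    Real.log n + (Real.log L - Real.eulerMascheroniConstant) / 2 ≤
      ∫ h, Real.log (∑ i, ‖h i‖) ∂complexGaussianVec n L := by
  have hn' : (0 : ℝ) < n := by exact_mod_cast hn
  have hi : ∀ i : Fin n, Integrable (fun h => 1 / (2 * n : ℝ) * Real.log (‖h i‖ ^ 2))
      (complexGaussianVec n L) := fun i => (integrable_log_norm_sq_vec hL i).const_mul _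
  refine le_trans (le_of_eq ?_) (integral_mono_ae ((integrable_const (Real.log n)).add
    (integrable_finsetSum Finset.univ fun i _ => hi i)) (integrable_log_sum_norm hn hL) ?_)
  · simp only [Pi.add_apply]
    rw [integral_add (integrable_const _) (integrable_finsetSum _ fun i _ => hi i),
      integral_finsetSum _ fun i _ => hi i]
    have h : ∀ i : Fin n, ∫ h, Real.log (‖h i‖ ^ 2) ∂complexGaussianVec n L =
        Real.log L - Real.eulerMascheroniConstant := fun i =>
      (integral_comp_measurePreserving (measurePreserving_eval_complexGaussianVec n L i)
        (f := fun z => Real.log (‖z‖ ^ 2)) (by fun_prop)).trans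
        (integral_log_norm_sq_complexGaussian hL)
    simp only [integral_const_mul, h]
    simp
    field_simp
  · filter_upwards [ae_ne_zero_complexGaussianVec n hL] with h hh using le_log_sum_norm hn hh

end amplitude

/-! ### Law of the reflected gains, energy of the direct channels. -/

section reflected

variable {K NR : ℕ}

/-- The reflected channel gains `H_c θ` of the strong users under phases aligned with the weak
user. -/
def reflected (NB : ℕ) (LG : ℝ) (a : Fin NR → ℂ) (r : Fin (K + 1) → Fin NR → ℂ) : Fin K → ℂ :=
  (stack fun k : Fin K => cascaded NB LG a (r k.castSucc)) *ᵥ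
    alignedPhases (cascaded NB LG a (r (Fin.last K)))

lemma reflected_apply (NB : ℕ) (LG : ℝ) (a : Fin NR → ℂ) (r : Fin (K + 1) → Fin NR → ℂ)
    (k : Fin K) :
    reflected NB LG a r k = ∑ n, ((√(LG * NB) : ℂ) * a n *
      alignedPhases (cascaded NB LG a (r (Fin.last K))) n) * star (r k.castSucc n) := by
  simp only [reflected, mulVec, dotProduct, stack, of_apply, Pi.star_apply, cascaded_apply]
  refine Finset.sum_congr rfl fun n _ => ?_
  simp only [star_mul', star_star]
  simp only [Complex.star_def, Complex.conj_ofReal]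
  ring

lemma measurable_alignedPhases_cascaded (NB : ℕ) (LG : ℝ) (a : Fin NR → ℂ) (n : Fin NR) :
    Measurable fun h => alignedPhases (cascaded NB LG a h) n := by
  simp only [alignedPhases, cascaded_apply]
  have : Measurable fun h : Fin NR → ℂ =>
    Complex.arg ((√(LG * NB) : ℂ) * (star (a n) * h n)) :=
    Complex.measurable_arg.comp (by fun_prop)
  fun_prop

/-- Given the weak user, the gain is a linear combination of independent Gaussians whose
coefficients all have modulus `√(LG * NB)`. The conditional law is therefore the same for every
phase vector, and a skew product carries it over. -/
lemma measurePreserving_reflected {NB : ℕ} {LG : ℝ} (hLG : 0 < LG) {a : Fin NR → ℂ}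
    (ha : ∀ n, ‖a n‖ = 1) {Lr : Fin (K + 1) → ℝ} (hLr : ∀ k, 0 < Lr k) (k : Fin K) :
    MeasurePreserving (fun r => reflected NB LG a r k)
      (Measure.pi fun k => complexGaussianVec NR (Lr k))
      (complexGaussian (LG * NB * NR * Lr k.castSucc)) := by
  have hpair : MeasurePreserving (fun r : Fin (K + 1) → Fin NR → ℂ =>
      (r (Fin.last K), r k.castSucc)) (Measure.pi fun k => complexGaussianVec NR (Lr k))
      ((complexGaussianVec NR (Lr (Fin.last K))).prod
        (complexGaussianVec NR (Lr k.castSucc))) := by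
    refine ⟨by fun_prop, ?_⟩
    have hind := (iIndepFun_pi (μ := fun k => complexGaussianVec NR (Lr k))
      (X := fun _ => id) fun _ => aemeasurable_id).indepFun (Fin.castSucc_lt_last k).ne'
    refine (hind.map_prod_eq_prod_map_map
      (measurable_pi_apply _).aemeasurable (measurable_pi_apply _).aemeasurable).trans ?_
    exact congrArg₂ Measure.prod
      (measurePreserving_eval (fun k => complexGaussianVec NR (Lr k)) (Fin.last K)).map_eq
      (measurePreserving_eval (fun k => complexGaussianVec NR (Lr k)) k.castSucc).map_eq
  have hskew := MeasurePreserving.skew_product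
    (MeasurePreserving.id (complexGaussianVec NR (Lr (Fin.last K))))
    (μc := complexGaussianVec NR (Lr k.castSucc))
    (μd := complexGaussian (LG * NB * NR * Lr k.castSucc))
    (g := fun h y => ∑ n, ((√(LG * NB) : ℂ) * a n * alignedPhases (cascaded NB LG a h) n) *
      star (y n)) (by
        have := measurable_alignedPhases_cascaded NB LG a
        simp only [Function.uncurry_def]
        refine Finset.measurable_fun_sum _ fun n _ => ?_
        have h1 : Measurable fun p : (Fin NR → ℂ) × (Fin NR → ℂ) =>
          alignedPhases (cascaded NB LG a p.1) n := (this n).comp measurable_fst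
        have h2 : Measurable fun p : (Fin NR → ℂ) × (Fin NR → ℂ) => star (p.2 n) := by fun_prop
        exact (h1.const_mul _).mul h2)
    (Filter.Eventually.of_forall fun h => by
      rw [complexGaussianVec, map_sum_mul_star_complexGaussian fun _ => (hLr k.castSucc).le]
      congr 1
      simp only [norm_mul, ha, norm_alignedPhases_apply, Complex.norm_real, mul_one,
        Real.norm_of_nonneg (Real.sqrt_nonneg _), Real.sq_sqrt (show 0 ≤ LG * NB by positivity)]
      simp
      ring)
  have := (measurePreserving_snd.comp hskew).comp hpair
  convert! this using 1
  ext r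
  exact reflected_apply NB LG a r k

/-- The mean energy of a linear combination of the direct channels. -/
lemma lintegral_sum_norm_sq_direct (NB : ℕ) {Ld : Fin K → ℝ} (hLd : ∀ k, 0 < Ld k)
    {c : Fin K → ℂ} (hc : 0 < ∑ k, ‖c k‖ ^ 2 * Ld k) :
    ∫⁻ d, ENNReal.ofReal (∑ n, ‖((stack d)ᴴ *ᵥ c) n‖ ^ 2)
      ∂(Measure.pi fun k => complexGaussianVec NB (Ld k)) =
      NB * ENNReal.ofReal (∑ k, ‖c k‖ ^ 2 * Ld k) := by
  have hcol : ∀ n : Fin NB, MeasurePreserving (fun d : Fin K → Fin NB → ℂ => fun k => d k n)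
      (Measure.pi fun k => complexGaussianVec NB (Ld k))
      (Measure.pi fun k => complexGaussian (Ld k)) := fun n =>
    measurePreserving_pi _ _ fun k => measurePreserving_eval_complexGaussianVec NB (Ld k) n
  have hnorm : ∀ (d : Fin K → Fin NB → ℂ) n, ‖((stack d)ᴴ *ᵥ c) n‖ =
      ‖∑ k, star (c k) * star (d k n)‖ := fun d n => by
    rw [← norm_star]
    simp [mulVec, dotProduct, stack, mul_comm]
  simp only [hnorm]
  simp_rw [ENNReal.ofReal_sum_of_nonneg fun (n : Fin NB) _ => sq_nonneg (_ : ℝ)]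
  rw [lintegral_finsetSum _ fun n _ => by fun_prop]
  have hn : ∀ n : Fin NB, ∫⁻ d, ENNReal.ofReal (‖∑ k, star (c k) * star (d k n)‖ ^ 2)
      ∂(Measure.pi fun k => complexGaussianVec NB (Ld k)) =
      ENNReal.ofReal (∑ k, ‖c k‖ ^ 2 * Ld k) := fun n => by
    rw [(hcol n).lintegral_comp
      (f := fun z => ENNReal.ofReal (‖∑ k, star (c k) * star (z k)‖ ^ 2)) (by fun_prop),
      ← lintegral_norm_sq_complexGaussian hc]
    have := map_sum_mul_star_complexGaussian (fun k => (hLd k).le) fun k => star (c k)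
    simp only [norm_star] at this
    rw [← this, lintegral_map (by fun_prop) (by fun_prop)]
  simp only [hn, Finset.sum_const, Finset.card_univ, Fintype.card_fin, nsmul_eq_mul]

end reflected

/-! ### Joint channel law and integrability of `log (1 + M)`. -/

/-- The joint law of the direct and the reflecting channels. -/
def channelLaw (NB NR : ℕ) {K : ℕ} (Ld : Fin K → ℝ) (Lr : Fin (K + 1) → ℝ) :
    Measure ((Fin K → Fin NB → ℂ) × (Fin (K + 1) → Fin NR → ℂ)) :=
  (Measure.pi fun k => complexGaussianVec NB (Ld k)).prod
    (Measure.pi fun k => complexGaussianVec NR (Lr k))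

instance (NB NR : ℕ) {K : ℕ} (Ld : Fin K → ℝ) (Lr : Fin (K + 1) → ℝ) :
    IsProbabilityMeasure (channelLaw NB NR Ld Lr) := by
  unfold channelLaw
  infer_instance

/-- The channel mitigation term under phases aligned with the weak user. -/
def alignedMitigation {K NB NR : ℕ} (LG : ℝ) (a : Fin NR → ℂ) (b : Fin NB → ℂ)
    (x : (Fin K → Fin NB → ℂ) × (Fin (K + 1) → Fin NR → ℂ)) : ℝ :=
  mitigation b (stack x.1) (stack fun k : Fin K => cascaded NB LG a (x.2 k.castSucc))
    (alignedPhases (cascaded NB LG a (x.2 (Fin.last K))))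

section measurability

variable {X : Type*} [MeasurableSpace X] {n : Type*} [Fintype n] [DecidableEq n]

lemma measurable_det_of_entries {A : X → Matrix n n ℂ} (hA : ∀ i j, Measurable fun x => A x i j) :
    Measurable fun x => (A x).det := by
  simp only [det_apply']
  exact Finset.measurable_fun_sum _ fun σ _ =>
    (Finset.measurable_fun_prod _ fun i _ => hA _ _).const_mul _

lemma measurable_inv_of_entries {A : X → Matrix n n ℂ} (hA : ∀ i j, Measurable fun x => A x i j)
    (i j : n) : Measurable fun x => (A x)⁻¹ i j := by
  simp only [inv_def, Ring.inverse_eq_inv', Matrix.smul_apply, smul_eq_mul, adjugate_apply]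
  refine (measurable_det_of_entries hA).inv.mul (measurable_det_of_entries fun r s => ?_)
  by_cases h : r = j
  · subst h
    simp
  · simpa [updateRow_ne h] using hA r s

end measurability

variable {K NB NR : ℕ} {LG : ℝ} {a : Fin NR → ℂ} {b : Fin NB → ℂ} {Ld : Fin K → ℝ}
  {Lr : Fin (K + 1) → ℝ}

lemma measurable_reflected (NB : ℕ) (LG : ℝ) (a : Fin NR → ℂ) (k : Fin K) :
    Measurable fun r : Fin (K + 1) → Fin NR → ℂ => reflected NB LG a r k := by
  simp only [reflected_apply]
  refine Finset.measurable_fun_sum _ fun n _ => ?_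
  have h1 : Measurable fun r : Fin (K + 1) → Fin NR → ℂ =>
    alignedPhases (cascaded NB LG a (r (Fin.last K))) n :=
    (measurable_alignedPhases_cascaded NB LG a n).comp (measurable_pi_apply _)
  fun_prop

lemma measurable_alignedMitigation (LG : ℝ) (a : Fin NR → ℂ) (b : Fin NB → ℂ) :
    Measurable (alignedMitigation (K := K) LG a b) := by
  unfold alignedMitigation
  simp only [mitigation_eq, effective]
  have hv : ∀ k, Measurable fun x : (Fin K → Fin NB → ℂ) × (Fin (K + 1) → Fin NR → ℂ) =>
      (reflected NB LG a x.2 + stack x.1 *ᵥ b) k := fun k => by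
    simp only [Pi.add_apply]
    refine ((measurable_reflected NB LG a k).comp measurable_snd).add ?_
    simp only [mulVec, dotProduct, stack, of_apply, Pi.star_apply]
    fun_prop
  have hC : ∀ i j, Measurable fun x : (Fin K → Fin NB → ℂ) × (Fin (K + 1) → Fin NR → ℂ) =>
      Cs b (stack x.1) i j := fun i j => by
    simp only [Cs, Matrix.mul_apply, stack, of_apply, conjTranspose_apply, Pi.star_apply]
    fun_prop
  have hI := measurable_inv_of_entries hC
  refine Complex.measurable_re.comp ?_
  simp only [dotProduct, mulVec]
  refine Finset.measurable_fun_sum _ fun i _ => Measurable.mul ?_ ?_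
  · exact continuous_star.measurable.comp (hv i)
  · exact Finset.measurable_fun_sum _ fun j _ => (hI i j).mul (hv j)

lemma leadingMinor_eq_det (b : Fin NB → ℂ) (e : Fin (K + 1) → Fin NB) :
    leadingMinor b e K le_rfl = fun x => (bordered b e x).det := by
  ext x
  rfl

lemma negLogFinite_det_bordered {e : Fin (K + 1) → Fin NB}
    (he : Function.Injective e) (hbe : b (e 0) ≠ 0) (hLd : ∀ k, 0 < Ld k) :
    NegLogFinite (channelLaw NB NR Ld Lr) fun x => (bordered b e x.1).det := by
  have h := negLogFinite_leadingMinor he hbe hLd K le_rfl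
  have hm := measurable_leadingMinor b e K le_rfl
  rw [leadingMinor_eq_det] at h hm
  exact h.comp_measurePreserving measurePreserving_fst hm

lemma exists_columns (hNB : K + 1 ≤ NB) (hb : star b ⬝ᵥ b = 1) :
    ∃ e : Fin (K + 1) → Fin NB, Function.Injective e ∧ b (e 0) ≠ 0 := by
  obtain ⟨n, hn⟩ : ∃ n, b n ≠ 0 := by
    by_contra! h
    have : b = 0 := funext h
    simp [this] at hb
  -- The first `K + 1` columns, with a transposition bringing a nonzero coordinate of `b` to the
  -- front.
  refine ⟨fun i => Equiv.swap (Fin.castLE hNB 0) n (Fin.castLE hNB i),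
    (Equiv.injective _).comp (Fin.castLE_injective hNB), ?_⟩
  simpa only [Equiv.swap_apply_left] using hn

lemma logMoment_direct (hLd : ∀ k, 0 < Ld k) (k : Fin K) (n : Fin NB) :
    LogMoment (channelLaw NB NR Ld Lr) fun x => x.1 k n :=
  .of_integrable_norm (by fun_prop)
    (((measurePreserving_eval_complexGaussianVec NB (Ld k) n).comp
      ((measurePreserving_eval (fun k => complexGaussianVec NB (Ld k)) k).comp
        measurePreserving_fst)).integrable_comp_of_integrable
      (integrable_norm_complexGaussian (hLd k)))

lemma logMoment_reflected (hLr : ∀ k, 0 < Lr k) (k : Fin K) :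
    LogMoment (channelLaw NB NR Ld Lr) fun x => reflected NB LG a x.2 k := by
  simp only [reflected_apply]
  refine .sum _ fun n _ => .mul (.mul (.const _) ?_) (.star ?_)
  · refine .of_integrable_norm ((measurable_alignedPhases_cascaded NB LG a n).comp
      ((measurable_pi_apply _).comp measurable_snd)) ?_
    simp only [norm_alignedPhases_apply]
    exact integrable_const _
  · exact .of_integrable_norm (by fun_prop)
      (((measurePreserving_eval_complexGaussianVec NR (Lr k.castSucc) n).comp
        ((measurePreserving_eval (fun k => complexGaussianVec NR (Lr k)) k.castSucc).comp
          measurePreserving_snd)).integrable_comp_of_integrable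
        (integrable_norm_complexGaussian (hLr _)))

lemma logMoment_bordered (b : Fin NB → ℂ) (e : Fin (K + 1) → Fin NB) (hLd : ∀ k, 0 < Ld k)
    (i j : Fin (K + 1)) :
    LogMoment (channelLaw NB NR Ld Lr) fun x => bordered b e x.1 i j := by
  refine Fin.cases ?_ (fun i => ?_) i
  · simpa [bordered] using .const _
  · simpa [bordered] using logMoment_direct hLd i (e j)

lemma logMoment_supportedSolution {e : Fin (K + 1) → Fin NB}
    (he : Function.Injective e) (hbe : b (e 0) ≠ 0) (hLd : ∀ k, 0 < Ld k) (hLr : ∀ k, 0 < Lr k)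
    (n : Fin NB) : LogMoment (channelLaw NB NR Ld Lr)
      fun x => supportedSolution b e x.1 (reflected NB LG a x.2) n := by
  have hB := logMoment_bordered (NR := NR) (Lr := Lr) b e hLd
  have hlog := (LogMoment.det hB).integrable_log_norm (negLogFinite_det_bordered he hbe hLd)
  unfold supportedSolution
  refine .add (.sum _ fun j _ => ?_) (.const _)
  by_cases h : e j = n
  · simp only [h, if_true]
    refine .star (.sum _ fun i _ => .mul (.matrix_inv hB hlog j i) ?_)
    refine Fin.cases ?_ (fun i => ?_) i
    · simpa using .const _
    · simpa using (logMoment_reflected hLr i).star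
  · simpa only [h, if_false] using .const 0

/-- The feasible vector supported on `K + 1` columns dominates `M`, and its squared norm has a
finite logarithmic moment even if no ordinary moment is known. -/
lemma integrable_log_one_add_alignedMitigation (hNB : K + 1 ≤ NB) (hb : star b ⬝ᵥ b = 1)
    (hLd : ∀ k, 0 < Ld k) (hLr : ∀ k, 0 < Lr k) :
    Integrable (fun x => Real.log (1 + alignedMitigation LG a b x)) (channelLaw NB NR Ld Lr) := by
  obtain ⟨e, he, hbe⟩ := exists_columns hNB hb
  have hs := logMoment_supportedSolution (LG := LG) (a := a) he hbe hLd hLr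
  have hT : LogMoment (channelLaw NB NR Ld Lr) fun x =>
      ∑ n, star (supportedSolution b e x.1 (reflected NB LG a x.2) n) *
        supportedSolution b e x.1 (reflected NB LG a x.2) n :=
    .sum _ fun n _ => (hs n).star.mul (hs n)
  have hm := measurable_alignedMitigation (K := K) LG a b
  refine hT.integrable.mono' (Measurable.aestronglyMeasurable (by fun_prop)) ?_
  filter_upwards [(negLogFinite_det_bordered (NR := NR) (Lr := Lr) he hbe hLd).ne_zero] with x hx
  have h0 : 0 ≤ alignedMitigation LG a b x := mitigation_nonneg hb (isUnit_det_Cs hb hx) _ _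
  rw [Real.norm_of_nonneg (Real.log_nonneg (by linarith))]
  refine Real.log_le_log (by linarith) (add_le_add le_rfl ?_)
  have h1 : ∑ n, star (supportedSolution b e x.1 (reflected NB LG a x.2) n) *
      supportedSolution b e x.1 (reflected NB LG a x.2) n =
      ((∑ n, ‖supportedSolution b e x.1 (reflected NB LG a x.2) n‖ ^ 2 : ℝ) : ℂ) :=
    star_dotProduct_self _
  rw [h1, Complex.norm_real, Real.norm_of_nonneg (by positivity)]
  exact mitigation_le_supportedSolution hb hx _ _

lemma ae_alignedMitigation_nonneg (hNB : K + 1 ≤ NB) (hb : star b ⬝ᵥ b = 1)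
    (hLd : ∀ k, 0 < Ld k) :
    ∀ᵐ x ∂channelLaw NB NR Ld Lr, 0 ≤ alignedMitigation LG a b x := by
  obtain ⟨e, he, hbe⟩ := exists_columns hNB hb
  filter_upwards [(negLogFinite_det_bordered (NR := NR) (Lr := Lr) he hbe hLd).ne_zero] with x hx
  exact mitigation_nonneg hb (isUnit_det_Cs hb hx) _ _

/-! ### Lower bound for the mean logarithm of the mitigation term. -/

/-- The energy of the reflected gains, weighted by the direct path losses. -/
def weightedEnergy (NB : ℕ) (LG : ℝ) (a : Fin NR → ℂ) (Ld : Fin K → ℝ)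
    (r : Fin (K + 1) → Fin NR → ℂ) : ℝ :=
  ∑ k, ‖reflected NB LG a r k‖ ^ 2 / Ld k

/-- The energy of the direct channels combined with weights proportional to the reflected gains. -/
def combinedEnergy (LG : ℝ) (a : Fin NR → ℂ) (Ld : Fin K → ℝ)
    (x : (Fin K → Fin NB → ℂ) × (Fin (K + 1) → Fin NR → ℂ)) : ℝ :=
  ∑ n, ‖((stack x.1)ᴴ *ᵥ fun k => reflected NB LG a x.2 k / Ld k) n‖ ^ 2

lemma weightedEnergy_sq_le (hb : star b ⬝ᵥ b = 1)
    {x : (Fin K → Fin NB → ℂ) × (Fin (K + 1) → Fin NR → ℂ)}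
    (hC : IsUnit (Cs b (stack x.1)).det) :
    weightedEnergy NB LG a Ld x.2 ^ 2 ≤
      combinedEnergy LG a Ld x * (1 + alignedMitigation LG a b x) := by
  have : star (fun k => reflected NB LG a x.2 k / (Ld k : ℂ)) ⬝ᵥ reflected NB LG a x.2 =
      ((weightedEnergy NB LG a Ld x.2 : ℝ) : ℂ) := by
    simp only [dotProduct, weightedEnergy, Pi.star_apply]
    push_cast
    refine Finset.sum_congr rfl fun k _ => ?_
    rw [← Complex.conj_mul']
    simp only [Complex.star_def, map_div₀, Complex.conj_ofReal]
    ring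
  have h := norm_star_dotProduct_sq_le_mitigation hb hC
    (stack fun k : Fin K => cascaded NB LG a (x.2 k.castSucc))
    (alignedPhases (cascaded NB LG a (x.2 (Fin.last K))))
    fun k => reflected NB LG a x.2 k / (Ld k : ℂ)
  rw [← reflected, this, Complex.norm_real, Real.norm_eq_abs, sq_abs] at h
  exact h

lemma measurable_weightedEnergy (NB : ℕ) (LG : ℝ) (a : Fin NR → ℂ) (Ld : Fin K → ℝ) :
    Measurable (weightedEnergy NB LG a Ld) := by
  unfold weightedEnergy
  have := measurable_reflected (K := K) NB LG a
  fun_prop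

lemma measurable_combinedEnergy (LG : ℝ) (a : Fin NR → ℂ) (Ld : Fin K → ℝ) :
    Measurable (combinedEnergy (NB := NB) LG a Ld) := by
  unfold combinedEnergy
  simp only [mulVec, dotProduct, stack, conjTranspose_apply, of_apply, Pi.star_apply, star_star]
  have h : ∀ k, Measurable fun x : (Fin K → Fin NB → ℂ) × (Fin (K + 1) → Fin NR → ℂ) =>
      reflected NB LG a x.2 k := fun k => (measurable_reflected NB LG a k).comp measurable_snd
  fun_prop

/-- With the reflecting channels fixed, the weights `v k / Ld k` are chosen so that the conditional
mean of the numerator is `NB` times the denominator. Where the denominator vanishes, the quotient is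
`0`; hence only `≤`. -/
lemma lintegral_combinedEnergy_div_le (hLd : ∀ k, 0 < Ld k) :
    ∫⁻ x, ENNReal.ofReal (combinedEnergy LG a Ld x / weightedEnergy NB LG a Ld x.2)
      ∂channelLaw NB NR Ld Lr ≤ NB := by
  have hm1 := measurable_combinedEnergy (NB := NB) LG a Ld
  have hm2 := measurable_weightedEnergy NB LG a Ld
  have hm3 : Measurable fun x : (Fin K → Fin NB → ℂ) × (Fin (K + 1) → Fin NR → ℂ) =>
    weightedEnergy NB LG a Ld x.2 := hm2.comp measurable_snd
  rw [channelLaw, lintegral_prod_symm _ (by fun_prop)]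
  refine (lintegral_mono (g := fun _ => (NB : ℝ≥0∞)) fun r => ?_).trans_eq (by simp)
  have hQ : weightedEnergy NB LG a Ld r = ∑ k, ‖reflected NB LG a r k / (Ld k : ℂ)‖ ^ 2 * Ld k := by
    refine Finset.sum_congr rfl fun k _ => ?_
    have := hLd k
    rw [norm_div, Complex.norm_real, Real.norm_of_nonneg this.le]
    field_simp
  have hQ0 : 0 ≤ weightedEnergy NB LG a Ld r :=
    Finset.sum_nonneg fun k _ => div_nonneg (by positivity) (hLd k).le
  rcases hQ0.eq_or_lt with h | h
  · simp [← h]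
  · have hl := lintegral_sum_norm_sq_direct NB hLd (hQ ▸ h)
    simp only [combinedEnergy]
    simp_rw [div_eq_mul_inv _ (weightedEnergy NB LG a Ld r),
      ENNReal.ofReal_mul' (inv_nonneg.2 hQ0)]
    rw [lintegral_mul_const', hl, ← hQ, mul_assoc, ← ENNReal.ofReal_mul hQ0, mul_inv_cancel₀ h.ne']
    · simp
    · exact ENNReal.ofReal_ne_top

/-- Cauchy–Schwarz, the tangent line of the logarithm and its weighted concavity combined. -/
lemma le_log_one_add_of_sq_le {ι : Type*} [Fintype ι] [Nonempty ι] {N R Q M : ℝ} (hN : 0 < N)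
    (hM : 0 ≤ M) (hR : 0 ≤ R) {s y : ι → ℝ} (hs : ∀ i, 0 < s i) (hy : ∀ i, 0 < y i)
    (hQ : Q = ∑ i, s i * y i) (h : Q ^ 2 ≤ R * (1 + M)) :
    Real.log (∑ i, s i) + ∑ i, s i / (∑ j, s j) * Real.log (y i) - Real.log N + 1 - R / Q / N ≤
      Real.log (1 + M) := by
  have hlog := log_sum_add_le_log_sum_mul (Finset.univ_nonempty (α := ι))
    (fun i _ => hs i) (fun i _ => hy i)
  rw [← hQ] at hlog
  have hQ0 : 0 < Q := hQ ▸ Finset.sum_pos (fun i _ => mul_pos (hs i) (hy i)) Finset.univ_nonempty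
  have hR0 : 0 < R := by
    refine hR.lt_of_ne fun h0 => ?_
    rw [← h0, zero_mul] at h
    exact absurd h (not_le.2 (by positivity))
  have h1 : 2 * Real.log Q ≤ Real.log R + Real.log (1 + M) := by
    rw [← Real.log_mul hR0.ne' (by positivity)]
    refine le_trans (le_of_eq ?_) (Real.log_le_log (by positivity) h)
    rw [Real.log_pow]; norm_num
  -- The tangent at `1` replaces `log (R / Q)` by a term linear in `R / Q`, whose mean is
  -- controlled.
  have h2 := Real.log_le_sub_one_of_pos (show 0 < R / Q / N by positivity)
  rw [Real.log_div (by positivity) hN.ne', Real.log_div hR0.ne' hQ0.ne'] at h2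
  linarith

lemma le_integral_log_one_add_alignedMitigation (hK : 1 ≤ K) (hNB : K + 1 ≤ NB) (hNR : 1 ≤ NR)
    (hLG : 0 < LG) (ha : ∀ n, ‖a n‖ = 1) (hb : star b ⬝ᵥ b = 1)
    (hLd : ∀ k, 0 < Ld k) (hLr : ∀ k, 0 < Lr k) :
    Real.log (∑ k : Fin K, LG * NB * NR * Lr k.castSucc / Ld k) - Real.eulerMascheroniConstant -
      Real.log NB ≤ ∫ x, Real.log (1 + alignedMitigation LG a b x) ∂channelLaw NB NR Ld Lr := by
  have : Nonempty (Fin K) := ⟨⟨0, hK⟩⟩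
  have hNB' : (0 : ℝ) < NB := by exact_mod_cast (by omega : 0 < NB)
  have hNR' : (0 : ℝ) < NR := by exact_mod_cast hNR
  have hV : ∀ k : Fin K, 0 < LG * NB * NR * Lr k.castSucc := fun k => by
    have := hLr k.castSucc; positivity
  have hs : ∀ k : Fin K, 0 < LG * NB * NR * Lr k.castSucc / Ld k := fun k => div_pos (hV k) (hLd k)
  have hS : 0 < ∑ k : Fin K, LG * NB * NR * Lr k.castSucc / Ld k :=
    Finset.sum_pos (fun k _ => hs k) Finset.univ_nonempty
  have hMP : ∀ k : Fin K, MeasurePreserving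
      (fun x : (Fin K → Fin NB → ℂ) × (Fin (K + 1) → Fin NR → ℂ) => reflected NB LG a x.2 k)
      (channelLaw NB NR Ld Lr) (complexGaussian (LG * NB * NR * Lr k.castSucc)) := fun k =>
    (measurePreserving_reflected hLG ha hLr k).comp measurePreserving_snd
  have hlog : ∀ k : Fin K, Integrable (fun x => Real.log (‖reflected NB LG a x.2 k‖ ^ 2))
      (channelLaw NB NR Ld Lr) := fun k =>
    (hMP k).integrable_comp_of_integrable (integrable_log_norm_sq_complexGaussian (hV k))
  have hlogint : ∀ k : Fin K, ∫ x, Real.log (‖reflected NB LG a x.2 k‖ ^ 2)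
      ∂channelLaw NB NR Ld Lr =
        Real.log (LG * NB * NR * Lr k.castSucc) - Real.eulerMascheroniConstant := fun k =>
    (integral_comp_measurePreserving (hMP k) (f := fun z => Real.log (‖z‖ ^ 2))
      (by fun_prop)).trans (integral_log_norm_sq_complexGaussian (hV k))
  have hm1 := measurable_combinedEnergy (NB := NB) LG a Ld
  have hm2 : Measurable fun x : (Fin K → Fin NB → ℂ) × (Fin (K + 1) → Fin NR → ℂ) =>
    weightedEnergy NB LG a Ld x.2 := (measurable_weightedEnergy NB LG a Ld).comp measurable_snd
  have hR0 : ∀ x : (Fin K → Fin NB → ℂ) × (Fin (K + 1) → Fin NR → ℂ),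
      0 ≤ combinedEnergy LG a Ld x := fun x => Finset.sum_nonneg fun n _ => by positivity
  have hratio0 : ∀ x : (Fin K → Fin NB → ℂ) × (Fin (K + 1) → Fin NR → ℂ),
      0 ≤ combinedEnergy LG a Ld x / weightedEnergy NB LG a Ld x.2 := fun x =>
    div_nonneg (hR0 x) (Finset.sum_nonneg fun k _ => div_nonneg (by positivity) (hLd k).le)
  have hle := lintegral_combinedEnergy_div_le (NB := NB) (NR := NR) (LG := LG) (a := a)
    (Lr := Lr) hLd
  have hratio : Integrable (fun x => combinedEnergy LG a Ld x / weightedEnergy NB LG a Ld x.2)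
      (channelLaw NB NR Ld Lr) := by
    refine ⟨Measurable.aestronglyMeasurable (by fun_prop), ?_⟩
    refine lt_of_le_of_lt (le_of_eq ?_) (hle.trans_lt (ENNReal.natCast_lt_top NB))
    exact lintegral_congr fun x => Real.enorm_eq_ofReal (hratio0 x)
  have hratioint : ∫ x, combinedEnergy LG a Ld x / weightedEnergy NB LG a Ld x.2
      ∂channelLaw NB NR Ld Lr ≤ NB := by
    rw [integral_eq_lintegral_of_nonneg_ae (Filter.Eventually.of_forall hratio0)
      hratio.aestronglyMeasurable]
    exact ENNReal.toReal_le_of_le_ofReal hNB'.le (by simpa using hle)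
  set s : Fin K → ℝ := fun k => LG * NB * NR * Lr k.castSucc / Ld k with hsdef
  set S := ∑ k, s k with hSdef
  -- Weighted average of logarithms of normalized gains, each of mean `-γ`. The weights sum to `1`,
  -- so only the marginal laws of the gains matter.
  let F : (Fin K → Fin NB → ℂ) × (Fin (K + 1) → Fin NR → ℂ) → ℝ := fun x =>
    ∑ k, s k / S * (Real.log (‖reflected NB LG a x.2 k‖ ^ 2) -
      Real.log (LG * NB * NR * Lr k.castSucc))
  have hFi : ∀ k : Fin K, Integrable (fun x => s k / S *
      (Real.log (‖reflected NB LG a x.2 k‖ ^ 2) - Real.log (LG * NB * NR * Lr k.castSucc)))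
      (channelLaw NB NR Ld Lr) := fun k => ((hlog k).sub (integrable_const _)).const_mul _
  have hF : Integrable F (channelLaw NB NR Ld Lr) := integrable_finsetSum _ fun k _ => hFi k
  have hFint : ∫ x, F x ∂channelLaw NB NR Ld Lr = -Real.eulerMascheroniConstant := by
    simp only [F]
    rw [integral_finsetSum _ fun k _ => hFi k]
    have : ∀ k : Fin K, ∫ x, s k / S * (Real.log (‖reflected NB LG a x.2 k‖ ^ 2) -
        Real.log (LG * NB * NR * Lr k.castSucc)) ∂channelLaw NB NR Ld Lr =
        s k / S * -Real.eulerMascheroniConstant := fun k => by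
      rw [integral_const_mul, integral_sub (hlog k) (integrable_const _), hlogint]
      simp
    simp only [this]
    rw [← Finset.sum_mul, ← Finset.sum_div, div_self hS.ne', one_mul]
  have hc : Integrable (fun _ => Real.log S - Real.log NB + 1) (channelLaw NB NR Ld Lr) :=
    integrable_const _
  have hd := hratio.div_const (NB : ℝ)
  calc _ ≤ ∫ x, (Real.log S - Real.log NB + 1 + F x -
        combinedEnergy LG a Ld x / weightedEnergy NB LG a Ld x.2 / NB)
          ∂channelLaw NB NR Ld Lr := by
        have h1 := integral_sub (hc.add hF) hd
        simp only [Pi.add_apply] at h1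
        rw [h1, integral_add hc hF, hFint, integral_div]
        have := (div_le_one hNB').2 hratioint
        simp
        linarith
    _ ≤ _ := by
        obtain ⟨e, he, hbe⟩ := exists_columns hNB hb
        refine integral_mono_ae ((hc.add hF).sub hd)
          (integrable_log_one_add_alignedMitigation hNB hb hLd hLr) ?_
        have hne : ∀ᵐ x ∂channelLaw NB NR Ld Lr, ∀ k, reflected NB LG a x.2 k ≠ 0 :=
          ae_all_iff.2 fun k => (hMP k).quasiMeasurePreserving.ae
            (ae_ne_zero_complexGaussian (hV k))
        filter_upwards [hne, (negLogFinite_det_bordered (NR := NR) (Lr := Lr) he hbe hLd).ne_zero]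
          with x hx hdet
        have hC := isUnit_det_Cs hb hdet
        have hy : ∀ k, 0 < ‖reflected NB LG a x.2 k‖ ^ 2 := fun k => by
          have := norm_pos_iff.2 (hx k)
          positivity
        have := le_log_one_add_of_sq_le hNB' (M := alignedMitigation LG a b x)
          (mitigation_nonneg hb hC _ _) (hR0 x) hs
          (y := fun k => ‖reflected NB LG a x.2 k‖ ^ 2 / (LG * NB * NR * Lr k.castSucc))
          (fun k => div_pos (hy k) (hV k)) (Q := weightedEnergy NB LG a Ld x.2) (by
            refine Finset.sum_congr rfl fun k _ => ?_
            have h1 := (hV k).ne'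
            rw [div_mul_div_comm, mul_comm (Ld k), mul_div_mul_left _ _ h1]) (weightedEnergy_sq_le hb hC)
        refine le_trans (le_of_eq ?_) this
        simp only [F]
        simp_rw [Real.log_div (hy _).ne' (hV _).ne']
        ring

/-! ### Transfer to the probability space and conclusion. -/

lemma IIDRayleigh.hasLaw {Ω : Type*} [MeasurableSpace Ω] {μ : Measure Ω} [IsProbabilityMeasure μ]
    {hd : Fin K → Ω → Fin NB → ℂ} {hr : Fin (K + 1) → Ω → Fin NR → ℂ}
    (h : IIDRayleigh μ Ld Lr hd hr) :
    HasLaw (fun ω => (fun k => hd k ω, fun k => hr k ω)) (channelLaw NB NR Ld Lr) μ :=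
  h.indep_direct_reflect.hasLaw_prod (h.indep_direct.hasLaw_pi h.law_direct)
    (h.indep_reflect.hasLaw_pi h.law_reflect)

lemma measurePreserving_weak (NB : ℕ) (Ld : Fin K → ℝ) (Lr : Fin (K + 1) → ℝ) :
    MeasurePreserving (fun x : (Fin K → Fin NB → ℂ) × (Fin (K + 1) → Fin NR → ℂ) =>
      x.2 (Fin.last K)) (channelLaw NB NR Ld Lr) (complexGaussianVec NR (Lr (Fin.last K))) :=
  (measurePreserving_eval (fun k => complexGaussianVec NR (Lr k)) (Fin.last K)).comp
    measurePreserving_snd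

lemma norm_star_cascaded_dotProduct (NB : ℕ) (LG : ℝ) (ha : ∀ n, ‖a n‖ = 1) (h : Fin NR → ℂ) :
    ‖star (cascaded NB LG a h) ⬝ᵥ alignedPhases (cascaded NB LG a h)‖ =
      √(LG * NB) * ∑ n, ‖h n‖ := by
  rw [norm_star_dotProduct_alignedPhases, Finset.mul_sum]
  simp only [norm_cascaded_apply NB LG ha]

lemma log_gain (hLG : 0 < LG) (hNB : 1 ≤ NB) (hNR : 1 ≤ NR) {p : ℝ} (hp : 0 < p)
    {h : Fin NR → ℂ} (hh : ∀ n, h n ≠ 0) :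
    0 < (√(LG * NB) * ∑ n, ‖h n‖) ^ 2 * p ∧ Real.log ((√(LG * NB) * ∑ n, ‖h n‖) ^ 2 * p) =
      Real.log (LG * NB * p) + 2 * Real.log (∑ n, ‖h n‖) := by
  have : Nonempty (Fin NR) := ⟨⟨0, hNR⟩⟩
  have hNB' : (0 : ℝ) < NB := by exact_mod_cast hNB
  have hS : 0 < ∑ n, ‖h n‖ :=
    Finset.sum_pos (fun n _ => norm_pos_iff.2 (hh n)) Finset.univ_nonempty
  refine ⟨by positivity, ?_⟩
  rw [mul_pow, Real.sq_sqrt (by positivity), mul_right_comm,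
    Real.log_mul (by positivity) (by positivity), Real.log_pow]
  norm_num

end RIS

end

theorem corollary2 {Ω : Type*} [MeasurableSpace Ω] (μ : Measure Ω) [IsProbabilityMeasure μ]
    (K NB NR : ℕ) (hK : 1 ≤ K) (hNB : K + 1 ≤ NB) (hNR : 1 ≤ NR)
    (LG p : ℝ) (hLG : 0 < LG) (hp : 0 < p)
    (Ld : Fin K → ℝ) (hLd : ∀ k, 0 < Ld k)
    (Lr : Fin (K + 1) → ℝ) (hLr : ∀ k, 0 < Lr k)
    (a : Fin NR → ℂ) (ha : ∀ n, ‖a n‖ = 1)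
    (b : Fin NB → ℂ) (hb : ∑ n, ‖b n‖ ^ 2 = 1)
    (hd : Fin K → Ω → Fin NB → ℂ) (hr : Fin (K + 1) → Ω → Fin NR → ℂ)
    (hfading : RIS.IIDRayleigh μ Ld Lr hd hr)
    (hc : Fin (K + 1) → Ω → Fin NR → ℂ)
    (hhc : ∀ k ω, hc k ω = RIS.cascaded NB LG a (hr k ω))
    (θ : Ω → Fin NR → ℂ)
    (hθ : ∀ ω, θ ω = RIS.alignedPhases (hc (Fin.last K) ω)) :
    (Integrable (fun ω => RIS.seLinR p b (fun k => hd k ω) (fun k => hc k ω) (θ ω)) μ ∧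
      ∫ ω, RIS.seLinR p b (fun k => hd k ω) (fun k => hc k ω) (θ ω) ∂μ ≤
        Real.logb 2 (Real.pi * Real.exp Real.eulerMascheroniConstant / 4 * NR * NB *
          (Lr (Fin.last K) * p / ∑ k : Fin K, Lr k.castSucc / Ld k))) ∧
    (Integrable (fun ω => RIS.seDPCR p (fun k => hc k ω) (θ ω)) μ ∧
      Real.logb 2 (Real.exp (-Real.eulerMascheroniConstant) * LG * Lr (Fin.last K) * NB *
          (NR : ℝ) ^ 2 * p) ≤
        ∫ ω, RIS.seDPCR p (fun k => hc k ω) (θ ω) ∂μ) := by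
  have hK' : Nonempty (Fin K) := ⟨⟨0, hK⟩⟩
  have hNB' : (0 : ℝ) < NB := by exact_mod_cast (by omega : 0 < NB)
  have hNR' : (0 : ℝ) < NR := by exact_mod_cast hNR
  have hL : 0 < Lr (Fin.last K) := hLr _
  have hpi := Real.pi_pos
  have hlog2 : 0 < Real.log 2 := Real.log_pos one_lt_two
  have hb' : star b ⬝ᵥ b = 1 := by rw [RIS.star_dotProduct_self, hb, Complex.ofReal_one]
  have hT : 0 < ∑ k : Fin K, Lr k.castSucc / Ld k :=
    Finset.sum_pos (fun k _ => div_pos (hLr _) (hLd k)) Finset.univ_nonempty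
  let J : Ω → (Fin K → Fin NB → ℂ) × (Fin (K + 1) → Fin NR → ℂ) :=
    fun ω => (fun k => hd k ω, fun k => hr k ω)
  have hJ : HasLaw J (RIS.channelLaw NB NR Ld Lr) μ := hfading.hasLaw
  let S : (Fin K → Fin NB → ℂ) × (Fin (K + 1) → Fin NR → ℂ) → ℝ :=
    fun x => Real.log (∑ n, ‖x.2 (Fin.last K) n‖)
  let D : (Fin K → Fin NB → ℂ) × (Fin (K + 1) → Fin NR → ℂ) → ℝ :=
    fun x => Real.log (1 + RIS.alignedMitigation LG a b x)
  have hmw := RIS.measurePreserving_weak (NR := NR) NB Ld Lr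
  have hSi : Integrable S (RIS.channelLaw NB NR Ld Lr) :=
    hmw.integrable_comp_of_integrable (RIS.integrable_log_sum_norm hNR hL)
  have hSint : ∫ x, S x ∂(RIS.channelLaw NB NR Ld Lr) =
      ∫ h, Real.log (∑ n, ‖h n‖) ∂(RIS.complexGaussianVec NR (Lr (Fin.last K))) :=
    RIS.integral_comp_measurePreserving hmw (f := fun h => Real.log (∑ n, ‖h n‖)) (by fun_prop)
  have hDi : Integrable D (RIS.channelLaw NB NR Ld Lr) :=
    RIS.integrable_log_one_add_alignedMitigation hNB hb' hLd hLr
  have hSJ : Integrable (fun ω => S (J ω)) μ :=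
    (hJ.map_eq ▸ hSi).comp_aemeasurable hJ.aemeasurable
  have hDJ : Integrable (fun ω => D (J ω)) μ :=
    (hJ.map_eq ▸ hDi).comp_aemeasurable hJ.aemeasurable
  have hSJint : ∫ ω, S (J ω) ∂μ = ∫ x, S x ∂(RIS.channelLaw NB NR Ld Lr) := by
    rw [← hJ.map_eq, integral_map hJ.aemeasurable (hJ.map_eq ▸ hSi.aestronglyMeasurable)]
  have hDJint : ∫ ω, D (J ω) ∂μ = ∫ x, D x ∂(RIS.channelLaw NB NR Ld Lr) := by
    rw [← hJ.map_eq, integral_map hJ.aemeasurable (hJ.map_eq ▸ hDi.aestronglyMeasurable)]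
  have hne : ∀ᵐ ω ∂μ, ∀ n, hr (Fin.last K) ω n ≠ 0 :=
    ae_of_ae_map hJ.aemeasurable (hJ.map_eq ▸
      hmw.quasiMeasurePreserving.ae (RIS.ae_ne_zero_complexGaussianVec NR hL))
  have hnn : ∀ᵐ ω ∂μ, 0 ≤ RIS.alignedMitigation LG a b (J ω) :=
    ae_of_ae_map hJ.aemeasurable (hJ.map_eq ▸
      RIS.ae_alignedMitigation_nonneg hNB hb' hLd)
  have hdpc : (fun ω => RIS.seDPCR p (fun k => hc k ω) (θ ω)) =ᵐ[μ]
      fun ω => (Real.log (LG * NB * p) + 2 * S (J ω)) / Real.log 2 := by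
    filter_upwards [hne] with ω hω
    rw [RIS.seDPCR, hθ, hhc, RIS.norm_star_cascaded_dotProduct NB LG ha, Real.logb,
      (RIS.log_gain hLG (by omega) hNR hp hω).2]
  have hlin : (fun ω => RIS.seLinR p b (fun k => hd k ω) (fun k => hc k ω) (θ ω)) =ᵐ[μ]
      fun ω => (Real.log (LG * NB * p) + 2 * S (J ω) - D (J ω)) / Real.log 2 := by
    filter_upwards [hne, hnn] with ω hω h0
    obtain ⟨hpos, hgain⟩ := RIS.log_gain hLG (by omega : 1 ≤ NB) hNR hp hω
    have hmit : RIS.mitigation b (RIS.stack fun k => hd k ω)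
        (RIS.stack fun k : Fin K => hc k.castSucc ω) (θ ω) =
        RIS.alignedMitigation LG a b (J ω) := by
      simp only [RIS.alignedMitigation, hθ, hhc, J]
    have h1 : (1 + RIS.alignedMitigation LG a b (J ω)) ≠ 0 := by positivity
    rw [RIS.seLinR, hmit, hθ, hhc, RIS.norm_star_cascaded_dotProduct NB LG ha, Real.logb,
      Real.log_div hpos.ne' h1, hgain]
  have hcI : Integrable (fun _ : Ω => Real.log (LG * NB * p)) μ := integrable_const _
  have hgI : Integrable (fun ω => Real.log (LG * NB * p) + 2 * S (J ω)) μ :=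
    hcI.add (hSJ.const_mul 2)
  have hgint : ∫ ω, (Real.log (LG * NB * p) + 2 * S (J ω)) ∂μ = Real.log (LG * NB * p) +
      2 * ∫ h, Real.log (∑ n, ‖h n‖) ∂(RIS.complexGaussianVec NR (Lr (Fin.last K))) := by
    rw [integral_add hcI (hSJ.const_mul 2), integral_const_mul, hSJint, hSint]
    simp
  refine ⟨⟨((hgI.sub hDJ).div_const _).congr hlin.symm, ?_⟩,
    ⟨(hgI.div_const _).congr hdpc.symm, ?_⟩⟩
  · rw [integral_congr_ae hlin, integral_div, Real.logb]
    refine div_le_div_of_nonneg_right ?_ hlog2.le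
    rw [integral_sub hgI hDJ, hgint, hDJint]
    have h1 := RIS.integral_log_sum_norm_le hNR hL
    have h2 := RIS.le_integral_log_one_add_alignedMitigation hK hNB hNR hLG ha hb' hLd hLr
    have h3 : 2 * Real.log (NR * (√(Real.pi * Lr (Fin.last K)) / 2)) =
        Real.log (NR ^ 2 * Real.pi * Lr (Fin.last K) / 4) := by
      rw [show (2 : ℝ) = (2 : ℕ) by norm_num, ← Real.log_pow, mul_pow, div_pow,
        Real.sq_sqrt (by positivity)]
      congr 1
      norm_num
      ring
    have h4 : ∑ k : Fin K, LG * NB * NR * Lr k.castSucc / Ld k =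
        LG * NB * NR * ∑ k : Fin K, Lr k.castSucc / Ld k := by
      rw [Finset.mul_sum]
      exact Finset.sum_congr rfl fun k _ => mul_div_assoc _ _ _
    -- `LG` cancels between gain and mitigation, and the factor `NR` in the mitigation reduces `NR ^
    -- 2` to `NR`.
    have h5 : Real.log (Real.pi * Real.exp Real.eulerMascheroniConstant / 4 * NR * NB *
          (Lr (Fin.last K) * p / ∑ k : Fin K, Lr k.castSucc / Ld k)) =
        Real.log (LG * NB * p) + Real.log (NR ^ 2 * Real.pi * Lr (Fin.last K) / 4) -
          (Real.log (LG * NB * NR * ∑ k : Fin K, Lr k.castSucc / Ld k) -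
            Real.eulerMascheroniConstant - Real.log NB) := by
      rw [← Real.log_mul (by positivity) (by positivity)]
      conv_rhs => rw [← Real.log_exp Real.eulerMascheroniConstant]
      rw [← Real.log_div (by positivity) (by positivity),
        ← Real.log_div (by positivity) (by positivity),
        ← Real.log_div (by positivity) (by positivity)]
      congr 1
      field_simp
    rw [h4] at h2
    rw [h5]
    have h6 : ∫ x, D x ∂(RIS.channelLaw NB NR Ld Lr) =
      ∫ x, Real.log (1 + RIS.alignedMitigation LG a b x) ∂(RIS.channelLaw NB NR Ld Lr) := rfl
    linarith
  · rw [integral_congr_ae hdpc, integral_div, Real.logb]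
    refine div_le_div_of_nonneg_right ?_ hlog2.le
    rw [hgint]
    have h1 := RIS.le_integral_log_sum_norm hNR hL
    have h2 : Real.log (Real.exp (-Real.eulerMascheroniConstant) * LG * Lr (Fin.last K) * NB *
        (NR : ℝ) ^ 2 * p) = Real.log (LG * NB * p) + 2 * Real.log NR +
          (Real.log (Lr (Fin.last K)) - Real.eulerMascheroniConstant) := by
      rw [show Real.exp (-Real.eulerMascheroniConstant) * LG * Lr (Fin.last K) * NB *
        (NR : ℝ) ^ 2 * p = (LG * NB * p) * (NR : ℝ) ^ 2 * Lr (Fin.last K) *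
          Real.exp (-Real.eulerMascheroniConstant) by ring,
        Real.log_mul (by positivity) (by positivity), Real.log_exp,
        Real.log_mul (by positivity) (by positivity),
        Real.log_mul (by positivity) (by positivity), Real.log_pow]
      push_cast
      ring
    linarith
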